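/- Let $\Bbbk$ be a field. For a set of multilinear identities, the operad of the corresponding variety of algebras has as its $n$-th component the space of multilinear elements of degree $n$ in $x_1,\dots,x_n$ of the free algebra of the variety, with $S_n$ permuting the variables and with composition given by substitution. Let $(a,b,c)=(ab)c-a(bc)$, and let $\mathrm{As}$, $\mathrm{Alt}$ and $\mathrm{Flex}$ be the operads over $\Bbbk$ of the varieties of algebras with one bilinear product defined, respectively, by the associative identity $(x_1,x_2,x_3)=0$, the alternative identities $$(x_1,x_2,x_3)+(x_2,x_1,x_3)=0,\qquad (x_1,x_2,x_3)+(x_1,x_3,x_2)=0,$$ and the flexible identity $(x_1,x_2,x_3)+(x_3,x_2,x_1)=0$. For binary quadratic operads $\mathcal P,\mathcal Q$, the white Manin product $\mathcal P\circ\mathcal Q$ is the quadratic operad generated by the $S_2$-module $E=\mathcal P(2)\otimes\mathcal Q(2)$ whose relations are the kernel of the natural map $\mathcal F_E(3)\to\mathcal P(3)\otimes\mathcal Q(3)$, where $\mathcal F_E$ is the free operad on $E$. Let $e_1=x_1x_2$ and $e_2=(12)e_1=x_2x_1$ in $\mathrm{Alt}(2)$, let $m=x_1x_2\in\mathrm{As}(2)$,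 and in $(\mathrm{As}\circ\mathrm{Alt})(2)$ put $$h_1=m\otimes e_1,\qquad h_2=(12)h_1,\qquad g_1=m\otimes e_2,\qquad g_2=(12)g_1.$$ The operad $\mathrm{Alt}$ is said to admit a nonsymmetric version if $(\mathrm{As}\circ\mathrm{Alt})/\{g_1-h_2=0,\ g_2-h_1=0\}\cong\mathrm{Alt}$ as symmetric operads. Then the following hold. 1. $\mathrm{Alt}$ does not admit a nonsymmetric version, that is, $$(\mathrm{As}\circ\mathrm{Alt})/\{g_1-h_2=0,\ g_2-h_1=0\}\not\cong\mathrm{Alt}.$$ 2. $(\mathrm{As}\circ\mathrm{Alt})/\{g_1-h_2=0,\ g_2-h_1=0\}\cong\mathrm{Flex}$. 3. $\dim\mathrm{Alt}(3)=7$ and $\dim\mathrm{Flex}(3)=9$; hence $\mathrm{Flex}\not\cong\mathrm{Alt}$. -/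

import Mathlib

universe u v w

open scoped TensorProduct

noncomputable section

namespace OperadTheory

/-! ### Bijections of finite sets used in the operad axioms -/

/-- `A ⊔ (B ⊔ {*}) ≃ (A ⊔ B) ⊔ {*}`. -/
def sumOption (A B : Type) : A ⊕ Option B ≃ Option (A ⊕ B) where
  toFun := Sum.elim (fun a => some (.inl a)) (fun b => b.map .inr)
  invFun x := x.elim (.inr none) (Sum.elim .inl (fun b => .inr (some b)))
  left_inv := by rintro (a | _ | b) <;> rfl
  right_inv := by rintro (_ | a | b) <;> rfl

/-- `(A ⊔ {*}) ⊔ B ≃ (A ⊔ B) ⊔ {*}`. -/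
def optionSum (A B : Type) : Option A ⊕ B ≃ Option (A ⊕ B) where
  toFun := Sum.elim (fun a => a.map .inl) (fun b => some (.inr b))
  invFun x := x.elim (.inl none) (Sum.elim (fun a => .inl (some a)) .inr)
  left_inv := by rintro ((_ | a) | b) <;> rfl
  right_inv := by rintro (_ | a | b) <;> rfl

/-- The exchange of the two extra points of `(A ⊔ {*}) ⊔ {*}`. -/
def optionSwap (A : Type) : Option (Option A) ≃ Option (Option A) where
  toFun x := x.elim (some none) (fun y => y.elim none (fun a => some (some a)))
  invFun x := x.elim (some none) (fun y => y.elim none (fun a => some (some a)))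
  left_inv := by rintro (_ | _ | a) <;> rfl
  right_inv := by rintro (_ | _ | a) <;> rfl

/-- `(A ⊔ B) ⊔ C ≃ (A ⊔ C) ⊔ B`. -/
def sumRightComm (A B C : Type) : (A ⊕ B) ⊕ C ≃ (A ⊕ C) ⊕ B where
  toFun := Sum.elim (Sum.elim (fun a => .inl (.inl a)) .inr) (fun c => .inl (.inr c))
  invFun := Sum.elim (Sum.elim (fun a => .inl (.inl a)) .inr) (fun c => .inl (.inr c))
  left_inv := by rintro ((a | b) | c) <;> rfl
  right_inv := by rintro ((a | b) | c) <;> rfl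

/-- `A ⊔ {()} ≃ A ⊔ {*}`. -/
def sumUnit (A : Type) : A ⊕ Unit ≃ Option A where
  toFun := Sum.elim some (fun _ => none)
  invFun x := x.elim (.inr ()) .inl
  left_inv := by rintro (a | b) <;> rfl
  right_inv := by rintro (_ | a) <;> rfl

/-- `{()} ⊔ A ≃ A ⊔ {*}`. -/
def unitSum (A : Type) : Unit ⊕ A ≃ Option A where
  toFun := Sum.elim (fun _ => none) some
  invFun x := x.elim (.inl ()) .inr
  left_inv := by rintro (a | b) <;> rfl
  right_inv := by rintro (_ | a) <;> rfl

/-- The one-point set as `∅ ⊔ {*}`. -/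
def unitOption : Unit ≃ Option Empty where
  toFun _ := none
  invFun _ := ()
  left_inv _ := rfl
  right_inv := by rintro (_ | a); · rfl
                  exact a.elim

/-- `{0, 1} ≃ {1} ⊔ {*}`, where `0` is sent to the extra point. -/
def finTwoOption : Fin 2 ≃ Option Unit where
  toFun i := if i = 0 then none else some ()
  invFun x := x.elim 0 (fun _ => 1)
  left_inv := by decide
  right_inv := by rintro (_ | a) <;> rfl

/-! ### Symmetric operads -/

/-- A symmetric operad in `k`-vector spaces, in the coordinate-free form with partial compositions:
a functor `A ↦ obj A` on finite sets and bijections (so `obj (Fin n)` is the space of `n`-ary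
operations, with its action of the symmetric group), a unit, and the compositions
`obj (A ⊔ {*}) ⊗ obj B → obj (A ⊔ B)` which insert the second operation at the input `*` of the
first one. They are equivariant, unital, and satisfy the sequential and the parallel
associativity axioms. -/
structure SymOperad (k : Type u) [Field k] where
  obj : (A : Type) → [Finite A] → Type v
  [acg : ∀ (A : Type) [Finite A], AddCommGroup (obj A)]
  [mod : ∀ (A : Type) [Finite A], Module k (obj A)]
  map : ∀ {A B : Type} [Finite A] [Finite B], (A ≃ B) → (obj A →ₗ[k] obj B)
  one : obj Unit
  comp : ∀ {A B : Type} [Finite A] [Finite B], obj (Option A) →ₗ[k] obj B →ₗ[k] obj (A ⊕ B)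
  map_refl : ∀ {A : Type} [Finite A] (p : obj A), map (Equiv.refl A) p = p
  map_trans : ∀ {A B C : Type} [Finite A] [Finite B] [Finite C] (e : A ≃ B) (f : B ≃ C)
    (p : obj A), map (e.trans f) p = map f (map e p)
  comp_map : ∀ {A A' B B' : Type} [Finite A] [Finite A'] [Finite B] [Finite B']
    (e : A ≃ A') (f : B ≃ B') (p : obj (Option A)) (q : obj B),
    comp (map (Equiv.optionCongr e) p) (map f q) = map (Equiv.sumCongr e f) (comp p q)
  comp_assoc : ∀ {A B C : Type} [Finite A] [Finite B] [Finite C]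
    (p : obj (Option A)) (q : obj (Option B)) (r : obj C),
    map (Equiv.sumAssoc A B C) (comp (map (sumOption A B) (comp p q)) r) = comp p (comp q r)
  comp_comm : ∀ {A B C : Type} [Finite A] [Finite B] [Finite C]
    (p : obj (Option (Option A))) (q : obj B) (r : obj C),
    map (sumRightComm A B C) (comp (map (optionSum A B) (comp p q)) r) =
      comp (map (optionSum A C) (comp (map (optionSwap A) p) r)) q
  comp_one : ∀ {A : Type} [Finite A] (p : obj (Option A)), map (sumUnit A) (comp p one) = p
  one_comp : ∀ {B : Type} [Finite B] (q : obj B),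
    map (Equiv.emptySum Empty B) (comp (map unitOption one) q) = q

attribute [instance] SymOperad.acg SymOperad.mod

variable {k : Type u} [Field k]

/-- An isomorphism of symmetric operads. -/
structure SymOperad.Iso (P : SymOperad.{u, v} k) (Q : SymOperad.{u, w} k) where
  equiv : ∀ (A : Type) [Finite A], P.obj A ≃ₗ[k] Q.obj A
  map_equiv : ∀ {A B : Type} [Finite A] [Finite B] (e : A ≃ B) (p : P.obj A),
    equiv B (P.map e p) = Q.map e (equiv A p)
  comp_equiv : ∀ {A B : Type} [Finite A] [Finite B] (p : P.obj (Option A)) (q : P.obj B),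
    equiv (A ⊕ B) (P.comp p q) = Q.comp (equiv (Option A) p) (equiv B q)
  one_equiv : equiv Unit P.one = Q.one

/-! ### Ideals and quotients -/

/-- An operadic ideal. -/
structure SymOperad.Idl (P : SymOperad.{u, v} k) where
  carrier : (A : Type) → [Finite A] → Submodule k (P.obj A)
  map_mem : ∀ {A B : Type} [Finite A] [Finite B] (e : A ≃ B) {p : P.obj A},
    p ∈ carrier A → P.map e p ∈ carrier B
  comp_mem_left : ∀ {A B : Type} [Finite A] [Finite B] {p : P.obj (Option A)} (q : P.obj B),
    p ∈ carrier (Option A) → P.comp p q ∈ carrier (A ⊕ B)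
  comp_mem_right : ∀ {A B : Type} [Finite A] [Finite B] (p : P.obj (Option A)) {q : P.obj B},
    q ∈ carrier B → P.comp p q ∈ carrier (A ⊕ B)

/-- The smallest operadic ideal that contains a given set of operations; `⟨n, p⟩ ∈ S` is an
operation `p` of arity `n`. -/
def SymOperad.idealSpan (P : SymOperad.{u, v} k) (S : Set (Σ n : ℕ, P.obj (Fin n))) : P.Idl where
  carrier A _ := ⨅ I : {I : P.Idl // ∀ x ∈ S, x.2 ∈ I.carrier (Fin x.1)}, I.1.carrier A
  map_mem e p hp := by
    rw [Submodule.mem_iInf] at hp ⊢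
    exact fun I => I.1.map_mem e (hp I)
  comp_mem_left q hp := by
    rw [Submodule.mem_iInf] at hp ⊢
    exact fun I => I.1.comp_mem_left q (hp I)
  comp_mem_right p q hq := by
    rw [Submodule.mem_iInf] at hq ⊢
    exact fun I => I.1.comp_mem_right p (hq I)

/-- The composition on the quotient by an ideal, induced by the composition of `P`. -/
def SymOperad.quotComp (P : SymOperad.{u, v} k) (I : P.Idl) {A B : Type} [Finite A] [Finite B] :
    (P.obj (Option A) ⧸ I.carrier (Option A)) →ₗ[k] (P.obj B ⧸ I.carrier B) →ₗ[k]
      (P.obj (A ⊕ B) ⧸ I.carrier (A ⊕ B)) :=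
  (I.carrier (Option A)).liftQ
    (LinearMap.mk₂ k
      (fun p q => (I.carrier B).mapQ (I.carrier (A ⊕ B)) (P.comp p)
        (fun _ hq => I.comp_mem_right p hq) q)
      (by
        intro p p' q
        obtain ⟨q, rfl⟩ := Submodule.mkQ_surjective _ q
        simp [map_add, LinearMap.add_apply])
      (by
        intro c p q
        obtain ⟨q, rfl⟩ := Submodule.mkQ_surjective _ q
        simp [map_smul, LinearMap.smul_apply])
      (fun p q q' => map_add _ q q')
      (fun c p q => map_smul _ c q))
    (by
      intro p hp
      rw [LinearMap.mem_ker]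
      ext q
      exact (Submodule.Quotient.mk_eq_zero _).2 (I.comp_mem_left q hp))

/-- The quotient of an operad by an operadic ideal. -/
def SymOperad.quot (P : SymOperad.{u, v} k) (I : P.Idl) : SymOperad.{u, v} k where
  obj A _ := P.obj A ⧸ I.carrier A
  map {A B} _ _ e := (I.carrier A).mapQ (I.carrier B) (P.map e) (fun _ hp => I.map_mem e hp)
  one := (I.carrier Unit).mkQ P.one
  comp := P.quotComp I
  map_refl {A} _ p := by
    obtain ⟨p, rfl⟩ := Submodule.mkQ_surjective _ p
    exact congrArg (I.carrier (A)).mkQ (P.map_refl p)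
  map_trans {A B C} _ _ _ e f p := by
    obtain ⟨p, rfl⟩ := Submodule.mkQ_surjective _ p
    exact congrArg (I.carrier (C)).mkQ (P.map_trans e f p)
  comp_map {A A' B B'} _ _ _ _ e f p q := by
    obtain ⟨p, rfl⟩ := Submodule.mkQ_surjective _ p
    obtain ⟨q, rfl⟩ := Submodule.mkQ_surjective _ q
    exact congrArg (I.carrier (A' ⊕ B')).mkQ (P.comp_map e f p q)
  comp_assoc {A B C} _ _ _ p q r := by
    obtain ⟨p, rfl⟩ := Submodule.mkQ_surjective _ p
    obtain ⟨q, rfl⟩ := Submodule.mkQ_surjective _ q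
    obtain ⟨r, rfl⟩ := Submodule.mkQ_surjective _ r
    exact congrArg (I.carrier (A ⊕ (B ⊕ C))).mkQ (P.comp_assoc p q r)
  comp_comm {A B C} _ _ _ p q r := by
    obtain ⟨p, rfl⟩ := Submodule.mkQ_surjective _ p
    obtain ⟨q, rfl⟩ := Submodule.mkQ_surjective _ q
    obtain ⟨r, rfl⟩ := Submodule.mkQ_surjective _ r
    exact congrArg (I.carrier ((A ⊕ C) ⊕ B)).mkQ (P.comp_comm p q r)
  comp_one {A} _ p := by
    obtain ⟨p, rfl⟩ := Submodule.mkQ_surjective _ p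
    exact congrArg (I.carrier (Option A)).mkQ (P.comp_one p)
  one_comp {B} _ q := by
    obtain ⟨q, rfl⟩ := Submodule.mkQ_surjective _ q
    exact congrArg (I.carrier (B)).mkQ (P.one_comp q)

/-- The quotient of `P` by the relations `p = 0`, `p ∈ S`. -/
def SymOperad.quotBy (P : SymOperad.{u, v} k) (S : Set (Σ n : ℕ, P.obj (Fin n))) :
    SymOperad.{u, v} k :=
  P.quot (P.idealSpan S)

/-- The class of an operation of `P` in the quotient by the relations `S`. -/
def SymOperad.quotMk (P : SymOperad.{u, v} k) (S : Set (Σ n : ℕ, P.obj (Fin n)))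
    {A : Type} [Finite A] : P.obj A →ₗ[k] (P.quotBy S).obj A :=
  ((P.idealSpan S).carrier A).mkQ

/-! ### Hadamard product -/

/-- The Hadamard (arity-wise) tensor product of operads. -/
def SymOperad.hadamard (P : SymOperad.{u, v} k) (Q : SymOperad.{u, w} k) :
    SymOperad.{u, max v w} k where
  obj A _ := P.obj A ⊗[k] Q.obj A
  map e := TensorProduct.map (P.map e) (Q.map e)
  one := P.one ⊗ₜ Q.one
  comp := TensorProduct.map₂ P.comp Q.comp
  map_refl p := by
    induction p using TensorProduct.induction_on with
    | zero => simp
    | add x y hx hy => rw [map_add, hx, hy]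
    | tmul a b => simp [P.map_refl, Q.map_refl]
  map_trans e f p := by
    induction p using TensorProduct.induction_on with
    | zero => simp
    | add x y hx hy => simp only [map_add, hx, hy]
    | tmul a b => simp [P.map_trans, Q.map_trans]
  comp_map e f p q := by
    induction p using TensorProduct.induction_on with
    | zero => simp
    | add x y hx hy => simp only [map_add, LinearMap.add_apply, hx, hy]
    | tmul a b =>
      induction q using TensorProduct.induction_on with
      | zero => simp
      | add x y hx hy => simp only [map_add, hx, hy]
      | tmul c d => simp [P.comp_map, Q.comp_map]
  comp_assoc p q r := by
    induction p using TensorProduct.induction_on with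
    | zero => simp
    | add x y hx hy => simp only [map_add, LinearMap.add_apply, hx, hy]
    | tmul a b =>
      induction q using TensorProduct.induction_on with
      | zero => simp
      | add x y hx hy => simp only [map_add, LinearMap.add_apply, hx, hy]
      | tmul c d =>
        induction r using TensorProduct.induction_on with
        | zero => simp
        | add x y hx hy => simp only [map_add, hx, hy]
        | tmul c d => simp [P.comp_assoc, Q.comp_assoc]
  comp_comm p q r := by
    induction p using TensorProduct.induction_on with
    | zero => simp
    | add x y hx hy => simp only [map_add, LinearMap.add_apply, hx, hy]
    | tmul a b =>
      induction q using TensorProduct.induction_on with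
      | zero => simp
      | add x y hx hy => simp only [map_add, LinearMap.add_apply, hx, hy]
      | tmul c d =>
        induction r using TensorProduct.induction_on with
        | zero => simp
        | add x y hx hy => simp only [map_add, LinearMap.add_apply, hx, hy]
        | tmul c d => simp [P.comp_comm, Q.comp_comm]
  comp_one p := by
    induction p using TensorProduct.induction_on with
    | zero => simp
    | add x y hx hy => simp only [map_add, LinearMap.add_apply, hx, hy]
    | tmul a b => simp [P.comp_one, Q.comp_one]
  one_comp q := by
    induction q using TensorProduct.induction_on with
    | zero => simp
    | add x y hx hy => simp only [map_add, hx, hy]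
    | tmul a b => simp [P.one_comp, Q.one_comp]

/-! ### The free operad on a set of binary operations -/

/-- Nonassociative monomials in the variables `X` with binary operation symbols `G`. -/
inductive BinTerm (G : Type v) (X : Type) : Type v
  | var (x : X) : BinTerm G X
  | node (g : G) (l r : BinTerm G X) : BinTerm G X

namespace BinTerm

variable {G : Type v} {X Y Z : Type}

/-- The set of leaves (occurrences of variables) of a monomial. -/
def Leaf : BinTerm G X → Type
  | var _ => Unit
  | node _ l r => l.Leaf ⊕ r.Leaf

instance finite_leaf : ∀ t : BinTerm G X, Finite t.Leaf
  | var _ => inferInstanceAs (Finite Unit)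
  | node _ l r =>
    haveI := finite_leaf l
    haveI := finite_leaf r
    inferInstanceAs (Finite (l.Leaf ⊕ r.Leaf))

/-- The variable at a leaf. -/
def label : (t : BinTerm G X) → t.Leaf → X
  | var x => fun _ => x
  | node _ l r => Sum.elim l.label r.label

/-- A monomial is multilinear in the variables `X` if every variable occurs exactly once. -/
def IsMultilinear (t : BinTerm G X) : Prop := Function.Bijective t.label

/-- Substitution of monomials for variables. -/
def bind : BinTerm G X → (X → BinTerm G Y) → BinTerm G Y
  | var x, f => f x
  | node g l r, f => node g (l.bind f) (r.bind f)

/-- Renaming of variables. -/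
def rename (f : X → Y) (t : BinTerm G X) : BinTerm G Y := t.bind (fun x => var (f x))

theorem bind_bind (t : BinTerm G X) (f : X → BinTerm G Y) (g : Y → BinTerm G Z) :
    (t.bind f).bind g = t.bind (fun x => (f x).bind g) := by
  induction t with
  | var x => rfl
  | node a l r hl hr => simp [bind, hl, hr]

theorem bind_var (t : BinTerm G X) : t.bind var = t := by
  induction t with
  | var x => rfl
  | node a l r hl hr => simp [bind, hl, hr]

/-- The leaves of a substitution. -/
def leafBind : (t : BinTerm G X) → (f : X → BinTerm G Y) →
    ((Σ i : t.Leaf, (f (t.label i)).Leaf) ≃ (t.bind f).Leaf)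
  | var x, f => Equiv.uniqueSigma (fun _ : Unit => (f x).Leaf)
  | node _ l r, f =>
    (Equiv.sumSigmaDistrib
      (fun i : l.Leaf ⊕ r.Leaf => (f (Sum.elim l.label r.label i)).Leaf)).trans
      (Equiv.sumCongr (leafBind l f) (leafBind r f))

theorem label_leafBind (t : BinTerm G X) (f : X → BinTerm G Y) (i : t.Leaf)
    (j : (f (t.label i)).Leaf) : (t.bind f).label (leafBind t f ⟨i, j⟩) = (f (t.label i)).label j := by
  induction t with
  | var x => rfl
  | node a l r hl hr =>
    rcases i with i | i
    · exact hl i j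
    · exact hr i j

/-- A substitution into a multilinear monomial is multilinear if every variable `y` occurs
exactly once in exactly one of the substituted monomials. -/
theorem IsMultilinear.bind {t : BinTerm G X} (ht : t.IsMultilinear) {f : X → BinTerm G Y}
    (hf : Function.Bijective (fun z : (Σ x : X, (f x).Leaf) => (f z.1).label z.2)) :
    (t.bind f).IsMultilinear := by
  have key : (t.bind f).label ∘ leafBind t f =
      (fun z : (Σ x : X, (f x).Leaf) => (f z.1).label z.2) ∘
        (Equiv.sigmaCongrLeft (β := fun x => (f x).Leaf) (Equiv.ofBijective _ ht)) := by
    funext ⟨i, j⟩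
    exact label_leafBind t f i j
  have h2 : Function.Bijective ((t.bind f).label ∘ leafBind t f) := by
    rw [key]
    exact hf.comp (Equiv.bijective _)
  exact (Function.Bijective.of_comp_iff _ (leafBind t f).bijective).1 h2

theorem IsMultilinear.rename {t : BinTerm G X} (ht : t.IsMultilinear) (e : X ≃ Y) :
    (t.rename e).IsMultilinear := by
  refine ht.bind ⟨?_, ?_⟩
  · rintro ⟨x, ⟨⟩⟩ ⟨y, ⟨⟩⟩ h
    obtain rfl : x = y := e.injective h
    rfl
  · exact fun y => ⟨⟨e.symm y, ()⟩, e.apply_symm_apply y⟩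

/-- Insertion of `s` at the variable `*` of `t`. -/
def insert {A B : Type} (t : BinTerm G (Option A)) (s : BinTerm G B) : BinTerm G (A ⊕ B) :=
  t.bind (fun x => x.elim (s.rename .inr) (fun a => var (.inl a)))

theorem IsMultilinear.insert {A B : Type} {t : BinTerm G (Option A)} {s : BinTerm G B}
    (ht : t.IsMultilinear) (hs : s.IsMultilinear) : (t.insert s).IsMultilinear := by
  have hl : ∀ z : (Σ i : s.Leaf, Unit),
      (s.rename (Sum.inr : B → A ⊕ B)).label (leafBind s (fun b => var (Sum.inr b)) z) = Sum.inr (s.label z.1) :=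
    fun z => label_leafBind s (fun b => var (Sum.inr b)) z.1 z.2
  refine ht.bind ⟨?_, ?_⟩
  · rintro ⟨_ | a, i⟩ ⟨_ | b, j⟩ h
    · obtain ⟨i, rfl⟩ := (leafBind s _).surjective i
      obtain ⟨j, rfl⟩ := (leafBind s _).surjective j
      have h' := (hl i).symm.trans (h.trans (hl j))
      have h2 : i.1 = j.1 := hs.1 (Sum.inr_injective h')
      obtain ⟨i, ⟨⟩⟩ := i
      obtain ⟨j, ⟨⟩⟩ := j
      obtain rfl : i = j := h2
      rfl
    · obtain ⟨i, rfl⟩ := (leafBind s _).surjective i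
      exact absurd ((hl i).symm.trans h) (by exact Sum.inr_ne_inl)
    · obtain ⟨j, rfl⟩ := (leafBind s _).surjective j
      exact absurd (h.trans (hl j)) (by exact Sum.inl_ne_inr)
    · obtain rfl : a = b := Sum.inl_injective h
      rfl
  · rintro (a | b)
    · exact ⟨⟨some a, ()⟩, rfl⟩
    · obtain ⟨i, rfl⟩ := hs.2 b
      exact ⟨⟨none, leafBind s _ ⟨i, ()⟩⟩, hl ⟨i, ()⟩⟩

end BinTerm

/-- Multilinear monomials. -/
abbrev MTerm (G : Type v) (A : Type) : Type v := {t : BinTerm G A // t.IsMultilinear}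

namespace MTerm

variable {G : Type v}

/-- Renaming of variables. -/
def map {A B : Type} (e : A ≃ B) (t : MTerm G A) : MTerm G B := ⟨t.1.rename e, t.2.rename e⟩

/-- Insertion of a monomial at the variable `*`. -/
def insert {A B : Type} (t : MTerm G (Option A)) (s : MTerm G B) : MTerm G (A ⊕ B) :=
  ⟨t.1.insert s.1, t.2.insert s.2⟩

theorem map_refl {A : Type} (t : MTerm G A) : t.map (Equiv.refl A) = t :=
  Subtype.ext (BinTerm.bind_var t.1)

theorem map_trans {A B C : Type} (e : A ≃ B) (f : B ≃ C) (t : MTerm G A) :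
    t.map (e.trans f) = (t.map e).map f :=
  Subtype.ext (BinTerm.bind_bind t.1 (fun x => .var (e x)) (fun y => .var (f y))).symm

theorem insert_map {A A' B B' : Type} (e : A ≃ A') (f : B ≃ B') (t : MTerm G (Option A))
    (s : MTerm G B) :
    (t.map (Equiv.optionCongr e)).insert (s.map f) = (t.insert s).map (Equiv.sumCongr e f) := by
  refine Subtype.ext ?_
  simp only [map, insert, BinTerm.insert, BinTerm.rename, BinTerm.bind_bind]
  congr 1
  funext x
  rcases x with _ | a
  · simp [BinTerm.bind, BinTerm.bind_bind]
  · rfl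

theorem insert_assoc {A B C : Type} (t : MTerm G (Option A)) (s : MTerm G (Option B))
    (r : MTerm G C) :
    (((t.insert s).map (sumOption A B)).insert r).map (Equiv.sumAssoc A B C) =
      t.insert (s.insert r) := by
  refine Subtype.ext ?_
  simp only [map, insert, BinTerm.insert, BinTerm.rename, BinTerm.bind_bind]
  congr 1
  funext x
  rcases x with _ | a
  · simp only [Option.elim, BinTerm.bind_bind]
    congr 1
    funext y
    rcases y with _ | b
    · simp [BinTerm.bind, BinTerm.bind_bind, sumOption]
    · simp [BinTerm.bind, sumOption]
  · simp [BinTerm.bind, sumOption]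

theorem insert_comm {A B C : Type} (t : MTerm G (Option (Option A))) (s : MTerm G B)
    (r : MTerm G C) :
    (((t.insert s).map (optionSum A B)).insert r).map (sumRightComm A B C) =
      ((((t.map (optionSwap A)).insert r).map (optionSum A C)).insert s) := by
  refine Subtype.ext ?_
  simp only [map, insert, BinTerm.insert, BinTerm.rename, BinTerm.bind_bind]
  congr 1
  funext x
  rcases x with _ | _ | a <;>
    simp [BinTerm.bind, BinTerm.bind_bind, optionSum, optionSwap, sumRightComm]

theorem insert_one {A : Type} (t : MTerm G (Option A))
    (h : (BinTerm.var (G := G) ()).IsMultilinear) :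
    (t.insert ⟨.var (), h⟩).map (sumUnit A) = t := by
  refine Subtype.ext ?_
  simp only [map, insert, BinTerm.insert, BinTerm.rename, BinTerm.bind_bind]
  conv_rhs => rw [← BinTerm.bind_var t.1]
  congr 1
  funext x
  rcases x with _ | a <;> rfl

theorem one_insert {B : Type} (s : MTerm G B) (h : (BinTerm.var (G := G) ()).IsMultilinear) :
    ((map unitOption ⟨.var (), h⟩ : MTerm G (Option Empty)).insert s).map
      (Equiv.emptySum Empty B) = s := by
  refine Subtype.ext ?_
  simp only [map, insert, BinTerm.insert, BinTerm.rename, BinTerm.bind, unitOption,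
    Equiv.coe_fn_mk, Option.elim, BinTerm.bind_bind]
  exact BinTerm.bind_var s.1

end MTerm

/-- The bilinear extension of the insertion of monomials. -/
def magComp (k : Type u) [Field k] (G : Type v) (A B : Type) :
    (MTerm G (Option A) →₀ k) →ₗ[k] (MTerm G B →₀ k) →ₗ[k] (MTerm G (A ⊕ B) →₀ k) :=
  Finsupp.lift _ k _ (fun t => Finsupp.lmapDomain k k (MTerm.insert t))

theorem magComp_single (k : Type u) [Field k] (G : Type v) (A B : Type) (t : MTerm G (Option A))
    (s : MTerm G B) (c d : k) :
    magComp k G A B (Finsupp.single t c) (Finsupp.single s d) =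
      Finsupp.single (t.insert s) (c * d) := by
  simp only [magComp, Finsupp.lift_apply, Finsupp.sum_single_index, zero_smul,
    LinearMap.smul_apply, Finsupp.lmapDomain_apply, Finsupp.mapDomain_single,
    Finsupp.smul_single, smul_eq_mul]

/-- The free symmetric operad on a set `G` of binary operations (without symmetries): its
component at `A` has the multilinear nonassociative monomials in the variables `A` as a basis, and
the compositions are given by substitution. -/
def magmatic (k : Type u) [Field k] (G : Type v) : SymOperad.{u, max u v} k where
  obj A _ := MTerm G A →₀ k
  map e := Finsupp.lmapDomain k k (MTerm.map e)
  one := Finsupp.single ⟨.var (), Function.bijective_id⟩ 1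
  comp := magComp k G _ _
  map_refl p := by
    induction p using Finsupp.induction_linear with
    | zero => simp
    | add x y hx hy => rw [map_add, hx, hy]
    | single t c => simp [Finsupp.lmapDomain_apply, Finsupp.mapDomain_single, MTerm.map_refl]
  map_trans e f p := by
    induction p using Finsupp.induction_linear with
    | zero => simp
    | add x y hx hy => simp only [map_add, hx, hy]
    | single t c => simp [Finsupp.lmapDomain_apply, Finsupp.mapDomain_single, MTerm.map_trans]
  comp_map e f p q := by
    induction p using Finsupp.induction_linear with
    | zero => simp
    | add x y hx hy => simp only [map_add, LinearMap.add_apply, hx, hy]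
    | single t c =>
      induction q using Finsupp.induction_linear with
      | zero => simp
      | add x y hx hy => simp only [map_add, hx, hy]
      | single s d =>
        simp only [Finsupp.lmapDomain_apply, Finsupp.mapDomain_single, magComp_single,
            MTerm.insert_map]
  comp_assoc p q r := by
    induction p using Finsupp.induction_linear with
    | zero => simp
    | add x y hx hy => simp only [map_add, LinearMap.add_apply, hx, hy]
    | single t c =>
      induction q using Finsupp.induction_linear with
      | zero => simp
      | add x y hx hy => simp only [map_add, LinearMap.add_apply, hx, hy]
      | single s d =>
        induction r using Finsupp.induction_linear with
        | zero => simp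
        | add x y hx hy => simp only [map_add, hx, hy]
        | single m f =>
          simp only [Finsupp.lmapDomain_apply, Finsupp.mapDomain_single, magComp_single,
            MTerm.insert_assoc, mul_assoc]
  comp_comm p q r := by
    induction p using Finsupp.induction_linear with
    | zero => simp
    | add x y hx hy => simp only [map_add, LinearMap.add_apply, hx, hy]
    | single t c =>
      induction q using Finsupp.induction_linear with
      | zero => simp
      | add x y hx hy => simp only [map_add, LinearMap.add_apply, hx, hy]
      | single s d =>
        induction r using Finsupp.induction_linear with
        | zero => simp
        | add x y hx hy => simp only [map_add, LinearMap.add_apply, hx, hy]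
        | single m f =>
          simp only [Finsupp.lmapDomain_apply, Finsupp.mapDomain_single, magComp_single,
            MTerm.insert_comm, mul_right_comm]
  comp_one p := by
    induction p using Finsupp.induction_linear with
    | zero => simp
    | add x y hx hy => simp only [map_add, LinearMap.add_apply, hx, hy]
    | single t c =>
      simp only [Finsupp.lmapDomain_apply, Finsupp.mapDomain_single, magComp_single, mul_one]
      exact congrArg (fun s => Finsupp.single s c) (MTerm.insert_one t _)
  one_comp q := by
    induction q using Finsupp.induction_linear with
    | zero => simp
    | add x y hx hy => simp only [map_add, hx, hy]
    | single t c =>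
      simp only [Finsupp.lmapDomain_apply, Finsupp.mapDomain_single, magComp_single, one_mul]
      exact congrArg (fun s => Finsupp.single s c) (MTerm.one_insert t _)

/-- The monomial `t` as an operation. -/
def mono (k : Type u) [Field k] {G : Type v} {A : Type} [Finite A] (t : BinTerm G A)
    (ht : t.IsMultilinear) : (magmatic k G).obj A :=
  Finsupp.single ⟨t, ht⟩ 1

/-! ### Evaluation of monomials in an operad -/

/-- The composite `e (p, q)` of a binary operation `e` with operations `p` and `q`. -/
def SymOperad.comp₂ (P : SymOperad.{u, v} k) (e : P.obj (Fin 2)) {A B : Type} [Finite A] [Finite B]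
    (p : P.obj A) (q : P.obj B) : P.obj (A ⊕ B) :=
  P.comp (P.map (unitSum A) (P.comp (P.map finTwoOption e) p)) q

/-- The value of a monomial as an operation whose inputs are the leaves of the monomial, where a
symbol `g` is interpreted as the binary operation `φ g` of `P`. -/
def SymOperad.termValue (P : SymOperad.{u, v} k) {G : Type w} (φ : G → P.obj (Fin 2)) {X : Type} :
    (t : BinTerm G X) → P.obj t.Leaf
  | .var _ => P.one
  | .node g l r => P.comp₂ (φ g) (P.termValue φ l) (P.termValue φ r)

/-- The components of the morphism from the free operad on `G` to `P` which sends the generator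
`g` to `φ g`. -/
def SymOperad.lift (P : SymOperad.{u, v} k) {G : Type w} (φ : G → P.obj (Fin 2)) (A : Type)
    [Finite A] : (magmatic k G).obj A →ₗ[k] P.obj A :=
  Finsupp.lift (P.obj A) k (MTerm G A)
    (fun t => P.map (Equiv.ofBijective t.1.label t.2) (P.termValue φ t.1))

/-! ### The white Manin product -/

/-- The relations of the white Manin product: all relations of arities `2` and `3` which hold
between the elements of `P(2) ⊗ Q(2)` in the Hadamard product `P ⊗ Q`. -/
def SymOperad.whiteRel (P : SymOperad.{u, v} k) (Q : SymOperad.{u, w} k) :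
    Set (Σ n : ℕ, (magmatic k (P.obj (Fin 2) ⊗[k] Q.obj (Fin 2))).obj (Fin n)) :=
  {x | (x.1 = 2 ∨ x.1 = 3) ∧ (P.hadamard Q).lift (fun g => g) (Fin x.1) x.2 = 0}

/-- The white Manin product `P ∘ Q` of binary quadratic operads. It is the quadratic operad
generated by the `S₂`-module `E = P(2) ⊗ Q(2)` whose relations are the kernel of
`F_E(3) → P(3) ⊗ Q(3)`.

The free operad on the elements of `E` as symbols is used; its relations of arity `2` say that the
symbols depend linearly on the elements of `E`, and that the transposition acts on the symbols as
it does on `E`, so that they define the free operad `F_E`. -/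
def SymOperad.white (P : SymOperad.{u, v} k) (Q : SymOperad.{u, w} k) :
    SymOperad.{u, max u v w} k :=
  (magmatic k (P.obj (Fin 2) ⊗[k] Q.obj (Fin 2))).quotBy (P.whiteRel Q)

/-- `x₁x₂` for the product with symbol `g`. -/
theorem isMultilinear_mul {G : Type v} (g : G) :
    (BinTerm.node g (.var (0 : Fin 2)) (.var 1)).IsMultilinear := by
  constructor
  · rintro (⟨⟨⟩⟩ | ⟨⟨⟩⟩) (⟨⟨⟩⟩ | ⟨⟨⟩⟩) h
    · rfl
    · exact absurd h (by decide : (0 : Fin 2) ≠ 1)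
    · exact absurd h (by decide : (1 : Fin 2) ≠ 0)
    · rfl
  · intro i
    fin_cases i
    · exact ⟨.inl (), rfl⟩
    · exact ⟨.inr (), rfl⟩

/-- The binary operation of `P ∘ Q` given by `p ⊗ q ∈ P(2) ⊗ Q(2)`. -/
def SymOperad.whiteGen (P : SymOperad.{u, v} k) (Q : SymOperad.{u, w} k) (p : P.obj (Fin 2))
    (q : Q.obj (Fin 2)) : (P.white Q).obj (Fin 2) :=
  (magmatic k (P.obj (Fin 2) ⊗[k] Q.obj (Fin 2))).quotMk (P.whiteRel Q)
    (mono k (.node (p ⊗ₜ[k] q) (.var 0) (.var 1)) (isMultilinear_mul _))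

/-! ### Operads of varieties of algebras with one binary operation -/

theorem isMultilinear_left :
    (BinTerm.node () (.node () (.var (0 : Fin 3)) (.var 1)) (.var 2)).IsMultilinear := by
  constructor
  · rintro ((⟨⟨⟩⟩ | ⟨⟨⟩⟩) | ⟨⟨⟩⟩) ((⟨⟨⟩⟩ | ⟨⟨⟩⟩) | ⟨⟨⟩⟩) h <;>
      first
        | rfl
        | exact absurd h (by decide : (0 : Fin 3) ≠ 1)
        | exact absurd h (by decide : (0 : Fin 3) ≠ 2)
        | exact absurd h (by decide : (1 : Fin 3) ≠ 0)
        | exact absurd h (by decide : (1 : Fin 3) ≠ 2)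
        | exact absurd h (by decide : (2 : Fin 3) ≠ 0)
        | exact absurd h (by decide : (2 : Fin 3) ≠ 1)
  · intro i
    fin_cases i
    · exact ⟨.inl (.inl ()), rfl⟩
    · exact ⟨.inl (.inr ()), rfl⟩
    · exact ⟨.inr (), rfl⟩

theorem isMultilinear_right :
    (BinTerm.node () (.var (0 : Fin 3)) (.node () (.var 1) (.var 2))).IsMultilinear := by
  constructor
  · rintro (⟨⟨⟩⟩ | (⟨⟨⟩⟩ | ⟨⟨⟩⟩)) (⟨⟨⟩⟩ | (⟨⟨⟩⟩ | ⟨⟨⟩⟩)) h <;>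
      first
        | rfl
        | exact absurd h (by decide : (0 : Fin 3) ≠ 1)
        | exact absurd h (by decide : (0 : Fin 3) ≠ 2)
        | exact absurd h (by decide : (1 : Fin 3) ≠ 0)
        | exact absurd h (by decide : (1 : Fin 3) ≠ 2)
        | exact absurd h (by decide : (2 : Fin 3) ≠ 0)
        | exact absurd h (by decide : (2 : Fin 3) ≠ 1)
  · intro i
    fin_cases i
    · exact ⟨.inl (), rfl⟩
    · exact ⟨.inr (.inl ()), rfl⟩
    · exact ⟨.inr (.inr ()), rfl⟩

/-- The associator `(x₁x₂)x₃ - x₁(x₂x₃)`. -/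
def associator (k : Type u) [Field k] : (magmatic k Unit).obj (Fin 3) :=
  mono k (.node () (.node () (.var 0) (.var 1)) (.var 2)) isMultilinear_left -
    mono k (.node () (.var 0) (.node () (.var 1) (.var 2))) isMultilinear_right

/-- The associator `(x_{σ(1)}, x_{σ(2)}, x_{σ(3)})` with permuted variables. -/
def associatorPerm (k : Type u) [Field k] (σ : Equiv.Perm (Fin 3)) :
    (magmatic k Unit).obj (Fin 3) :=
  (magmatic k Unit).map σ (associator k)

/-- The associative identity `(x₁, x₂, x₃) = 0`. -/
def asRel (k : Type u) [Field k] : Set (Σ n : ℕ, (magmatic k Unit).obj (Fin n)) :=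
  {⟨3, associator k⟩}

/-- The multilinear alternative identities `(x₁, x₂, x₃) + (x₂, x₁, x₃) = 0` and
`(x₁, x₂, x₃) + (x₁, x₃, x₂) = 0`. -/
def altRel (k : Type u) [Field k] : Set (Σ n : ℕ, (magmatic k Unit).obj (Fin n)) :=
  {⟨3, associator k + associatorPerm k (Equiv.swap 0 1)⟩,
    ⟨3, associator k + associatorPerm k (Equiv.swap 1 2)⟩}

/-- The multilinear flexible identity `(x₁, x₂, x₃) + (x₃, x₂, x₁) = 0`. -/
def flexRel (k : Type u) [Field k] : Set (Σ n : ℕ, (magmatic k Unit).obj (Fin n)) :=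
  {⟨3, associator k + associatorPerm k (Equiv.swap 0 2)⟩}

/-- The operad of the variety of algebras with one binary operation and the identities `S`. -/
abbrev variety (k : Type u) [Field k] (S : Set (Σ n : ℕ, (magmatic k Unit).obj (Fin n))) :
    SymOperad.{u, u} k :=
  (magmatic k Unit).quotBy S

/-- The product `x₁x₂` of such a variety. -/
def variety.mul (k : Type u) [Field k] (S : Set (Σ n : ℕ, (magmatic k Unit).obj (Fin n))) :
    (variety k S).obj (Fin 2) :=
  (magmatic k Unit).quotMk S (mono k (.node () (.var 0) (.var 1)) (isMultilinear_mul _))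

/-- The operad of associative algebras. -/
def As (k : Type u) [Field k] : SymOperad.{u, u} k := variety k (asRel k)

/-- The operad of alternative algebras. -/
def Alt (k : Type u) [Field k] : SymOperad.{u, u} k := variety k (altRel k)

/-- The operad of flexible algebras. -/
def Flex (k : Type u) [Field k] : SymOperad.{u, u} k := variety k (flexRel k)

/-- The product `x₁x₂` in `As`. -/
def As.mul (k : Type u) [Field k] : (As k).obj (Fin 2) := variety.mul k (asRel k)

/-- The product `x₁x₂` in `Alt`. -/
def Alt.mul (k : Type u) [Field k] : (Alt k).obj (Fin 2) := variety.mul k (altRel k)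

/-! ### Nonsymmetric versions -/

section NonsymmetricVersion

variable (P : SymOperad.{u, v} k) (e : P.obj (Fin 2))

/-- The action of the transposition `(12)` on binary operations. -/
def SymOperad.flip : P.obj (Fin 2) →ₗ[k] P.obj (Fin 2) := P.map (Equiv.swap 0 1)

/-- `h₁ = x₁ ≺ x₂ = x₁x₂ ⊗ e₁` with `e₁ = e`. -/
def genH₁ : ((As k).white P).obj (Fin 2) := (As k).whiteGen P (As.mul k) e

/-- `h₂ = (12) h₁`. -/
def genH₂ : ((As k).white P).obj (Fin 2) := ((As k).white P).flip (genH₁ P e)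

/-- `g₁ = x₁ ≻ x₂ = x₁x₂ ⊗ e₂` with `e₂ = (12) e`. -/
def genG₁ : ((As k).white P).obj (Fin 2) := (As k).whiteGen P (As.mul k) (P.flip e)

/-- `g₂ = (12) g₁`. -/
def genG₂ : ((As k).white P).obj (Fin 2) := ((As k).white P).flip (genG₁ P e)

/-- The quotient `As ∘ P / {g₁ - h₂ = 0, g₂ - h₁ = 0}`, for an operad `P` which is generated by
`e₁ = e` and `e₂ = (12) e`. -/
def symmetrization : SymOperad.{u, max u v} k :=
  ((As k).white P).quotBy {⟨2, genG₁ P e - genH₂ P e⟩, ⟨2, genG₂ P e - genH₁ P e⟩}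

/-- `P` (generated by `e₁ = e` and `e₂ = (12) e`) admits a nonsymmetric version if it is isomorphic
to `As ∘ P / {g₁ - h₂ = 0, g₂ - h₁ = 0}`. -/
def AdmitsNonsymmetricVersion : Prop := Nonempty ((symmetrization P e).Iso P)

end NonsymmetricVersion

end OperadTheory

end

noncomputable section

namespace OperadTheory

variable {k : Type u} [Field k]

/-! ### Morphisms of symmetric operads -/

/-! The added relations set `m ⊗ e₂` equal to `(12)(m ⊗ e₁)`, so the quotient is generated by the
single product `m ⊗ e₁`. The question is which identities of degree three this product satisfies.

Since `As(3) = k[S₃]`, the space `As(3) ⊗ Alt(3)` is a sum of copies of `Alt(3)`, one for each word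
in the three letters. A composite of two elements of `As(2) ⊗ Alt(2)` has the same letter outside
the inner product in both tensor factors. In an associative word the middle letter always lies in
the inner product. Hence, over a word with middle letter `b`, only those eight of the twelve
alternative monomials occur whose inner product contains `b`. In `Alt(3)` the six associators agree
up to sign. Each of the four excluded monomials lies in exactly one associator, so four of the five
relations only eliminate these monomials. The one relation left between the other eight is `(a,b,c)
+ (c,b,a) = 0`, which is the flexible identity.

Accordingly there is a linear section `altToFlexThree` of `Flex(3) → Alt(3)` that fixes the eight
monomials. Transported to every word it gives `hadamardToFlexThree`, through which the map from the
free operad to `Flex` factors in arity three. The relations of `As ∘ Alt` therefore hold in `Flex`,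
which yields `symmetrizationToFlex`. Conversely, over the word `x₁x₂x₃` the flexible identity is a
consequence of alternativity, which yields `flexToSymmetrization`. The two are mutually inverse
because they are so on generators.

Dimensions are found by explicit coordinates. The six right-bracketed monomials are completed to a
basis by one associator in `Alt(3)` and by three, one for each middle letter, in `Flex(3)`. The
numbers 7 and 9 do not depend on the characteristic, and they separate the two operads.

The operadic background is the universal property of the free operad (`liftHom`, `magmatic_ext`),
factorization through quotients (`Hom.descend`), and an upper bound for ideals generated in one
arity (`idealSpan_carrier_le`). -/

theorem SymOperad.map_map (P : SymOperad.{u, v} k) {A B C : Type} [Finite A] [Finite B] [Finite C]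
    (e : A ≃ B) (f : B ≃ C) (p : P.obj A) : P.map f (P.map e p) = P.map (e.trans f) p :=
  (P.map_trans e f p).symm

theorem SymOperad.map_congr (P : SymOperad.{u, v} k) {A B : Type} [Finite A] [Finite B]
    {e f : A ≃ B} (h : ∀ a, e a = f a) (p : P.obj A) : P.map e p = P.map f p := by
  rw [Equiv.ext h]

theorem SymOperad.map_id (P : SymOperad.{u, v} k) {A : Type} [Finite A]
    {e : A ≃ A} (h : ∀ a, e a = a) (p : P.obj A) : P.map e p = p := by
  rw [P.map_congr (f := Equiv.refl A) h, P.map_refl]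

theorem SymOperad.eq_map_symm (P : SymOperad.{u, v} k) {A B : Type} [Finite A] [Finite B]
    {e : A ≃ B} {p : P.obj A} {q : P.obj B} (h : P.map e p = q) : p = P.map e.symm q := by
  rw [← h, P.map_map, P.map_id]
  simp

/-- A morphism of symmetric operads. -/
structure SymOperad.Hom (P : SymOperad.{u, v} k) (Q : SymOperad.{u, w} k) where
  app : ∀ (A : Type) [Finite A], P.obj A →ₗ[k] Q.obj A
  app_map : ∀ {A B : Type} [Finite A] [Finite B] (e : A ≃ B) (p : P.obj A),
    app B (P.map e p) = Q.map e (app A p)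
  app_comp : ∀ {A B : Type} [Finite A] [Finite B] (p : P.obj (Option A)) (q : P.obj B),
    app (A ⊕ B) (P.comp p q) = Q.comp (app (Option A) p) (app B q)
  app_one : app Unit P.one = Q.one

namespace SymOperad.Hom

variable {P : SymOperad.{u, v} k} {Q : SymOperad.{u, w} k}

/-- The kernel of a morphism. -/
def ker (f : P.Hom Q) : P.Idl where
  carrier A _ := LinearMap.ker (f.app A)
  map_mem e p hp := by
    rw [LinearMap.mem_ker] at hp ⊢
    rw [f.app_map, hp, map_zero]
  comp_mem_left q hp := by
    rw [LinearMap.mem_ker] at hp ⊢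
    rw [f.app_comp, hp, map_zero, LinearMap.zero_apply]
  comp_mem_right p q hq := by
    rw [LinearMap.mem_ker] at hq ⊢
    rw [f.app_comp, hq, map_zero]

/-- The composition of morphisms. -/
def comp {R : SymOperad.{u, v} k} (g : Q.Hom R) (f : P.Hom Q) : P.Hom R where
  app A _ := g.app A ∘ₗ f.app A
  app_map e p := by simp [f.app_map, g.app_map]
  app_comp p q := by simp [f.app_comp, g.app_comp]
  app_one := by simp [f.app_one, g.app_one]

theorem app_comp₂ (f : P.Hom Q) (e : P.obj (Fin 2)) {A B : Type} [Finite A] [Finite B]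
    (p : P.obj A) (q : P.obj B) :
    f.app (A ⊕ B) (P.comp₂ e p q) = Q.comp₂ (f.app _ e) (f.app _ p) (f.app _ q) := by
  simp only [SymOperad.comp₂, f.app_comp, f.app_map]

end SymOperad.Hom

theorem SymOperad.idealSpan_le {P : SymOperad.{u, v} k} {S : Set (Σ n : ℕ, P.obj (Fin n))}
    {I : P.Idl} (h : ∀ x ∈ S, x.2 ∈ I.carrier (Fin x.1)) (A : Type) [Finite A] :
    (P.idealSpan S).carrier A ≤ I.carrier A :=
  iInf_le (fun I : {I : P.Idl // ∀ x ∈ S, x.2 ∈ I.carrier (Fin x.1)} => I.1.carrier A) ⟨I, h⟩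

theorem SymOperad.mem_idealSpan {P : SymOperad.{u, v} k} {S : Set (Σ n : ℕ, P.obj (Fin n))}
    {x : Σ n : ℕ, P.obj (Fin n)} (hx : x ∈ S) : x.2 ∈ (P.idealSpan S).carrier (Fin x.1) :=
  (Submodule.mem_iInf _).2 fun I => I.2 x hx

theorem SymOperad.quotMk_eq_zero {P : SymOperad.{u, v} k} {S : Set (Σ n : ℕ, P.obj (Fin n))}
    {n : ℕ} {p : P.obj (Fin n)} (hp : ⟨n, p⟩ ∈ S) : P.quotMk S p = 0 :=
  (Submodule.Quotient.mk_eq_zero _).2 (mem_idealSpan hp)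

theorem SymOperad.quotMk_surjective (P : SymOperad.{u, v} k) (S : Set (Σ n : ℕ, P.obj (Fin n)))
    {A : Type} [Finite A] : Function.Surjective (P.quotMk S (A := A)) :=
  Submodule.mkQ_surjective _

/-- The projection to a quotient. -/
def SymOperad.quotHom (P : SymOperad.{u, v} k) (S : Set (Σ n : ℕ, P.obj (Fin n))) :
    P.Hom (P.quotBy S) where
  app _ _ := P.quotMk S
  app_map _ _ := rfl
  app_comp _ _ := rfl
  app_one := rfl

/-- A morphism which satisfies the relations `S` factors through the quotient by `S`. -/
def SymOperad.Hom.descend {P : SymOperad.{u, v} k} {Q : SymOperad.{u, w} k} (f : P.Hom Q)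
    (S : Set (Σ n : ℕ, P.obj (Fin n))) (h : ∀ x ∈ S, f.app (Fin x.1) x.2 = 0) :
    (P.quotBy S).Hom Q where
  app A _ := ((P.idealSpan S).carrier A).liftQ (f.app A)
    (P.idealSpan_le (I := f.ker) (fun x hx => h x hx) A)
  app_map e p := by
    obtain ⟨p, rfl⟩ := P.quotMk_surjective S p
    exact f.app_map e p
  app_comp p q := by
    obtain ⟨p, rfl⟩ := P.quotMk_surjective S p
    obtain ⟨q, rfl⟩ := P.quotMk_surjective S q
    exact f.app_comp p q
  app_one := f.app_one

/-- Mutually inverse morphisms give an isomorphism. -/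
def SymOperad.Hom.toIso {P : SymOperad.{u, v} k} {Q : SymOperad.{u, w} k} (f : P.Hom Q)
    (g : Q.Hom P) (hgf : ∀ (A : Type) [Finite A] (p : P.obj A), g.app A (f.app A p) = p)
    (hfg : ∀ (A : Type) [Finite A] (q : Q.obj A), f.app A (g.app A q) = q) : P.Iso Q where
  equiv A _ := LinearEquiv.ofLinearMap (f.app A) (g.app A) (LinearMap.ext (hfg A))
    (LinearMap.ext (hgf A))
  map_equiv := f.app_map
  comp_equiv := f.app_comp
  one_equiv := f.app_one

/-- The composite of an isomorphism with the inverse of another one. -/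
def SymOperad.Iso.symmTrans {P Q R : SymOperad.{u, v} k} (f : P.Iso Q) (g : P.Iso R) :
    Q.Iso R where
  equiv A _ := (f.equiv A).symm.trans (g.equiv A)
  map_equiv {A B} _ _ e q := by
    have h := f.map_equiv e ((f.equiv A).symm q)
    rw [LinearEquiv.apply_symm_apply] at h
    simp [← h, g.map_equiv]
  comp_equiv {A B} _ _ p q := by
    have h := f.comp_equiv ((f.equiv _).symm p) ((f.equiv _).symm q)
    rw [LinearEquiv.apply_symm_apply, LinearEquiv.apply_symm_apply] at h
    simp [← h, g.comp_equiv]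
  one_equiv := by simp [← f.one_equiv, g.one_equiv]

/-! ### The universal property of the free operad -/

/-- A multilinear monomial, as an operation. -/
def magmaticTerm (k : Type u) [Field k] {G : Type w} {A : Type} [Finite A] (t : MTerm G A) :
    (magmatic k G).obj A :=
  Finsupp.single t 1

theorem magmatic_linearMap_ext {G : Type w} {A : Type} [Finite A] {M : Type*} [AddCommGroup M]
    [Module k M] {f g : (magmatic k G).obj A →ₗ[k] M}
    (h : ∀ t, f (magmaticTerm k t) = g (magmaticTerm k t)) : f = g :=
  Finsupp.lhom_ext' fun t => LinearMap.ext_ring (h t)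

theorem magmatic_map_term {G : Type w} {A B : Type} [Finite A] [Finite B] (e : A ≃ B)
    (t : MTerm G A) : (magmatic k G).map e (magmaticTerm k t) = magmaticTerm k (t.map e) :=
  Finsupp.mapDomain_single

theorem magmatic_comp_term {G : Type w} {A B : Type} [Finite A] [Finite B]
    (t : MTerm G (Option A)) (s : MTerm G B) :
    (magmatic k G).comp (magmaticTerm k t) (magmaticTerm k s) = magmaticTerm k (t.insert s) :=
  (magComp_single k G A B t s 1 1).trans (by rw [mul_one]; rfl)

/-! ### Iterated compositions and the evaluation of substituted monomials -/

namespace SymOperad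

variable (P : SymOperad.{u, v} k)

theorem comp_map_left {A A' B : Type} [Finite A] [Finite A'] [Finite B] (e : A ≃ A')
    (p : P.obj (Option A)) (q : P.obj B) :
    P.comp (P.map (Equiv.optionCongr e) p) q =
      P.map (Equiv.sumCongr e (Equiv.refl B)) (P.comp p q) := by
  rw [← P.comp_map, P.map_refl]

theorem comp_map_right {A B B' : Type} [Finite A] [Finite B] [Finite B'] (f : B ≃ B')
    (p : P.obj (Option A)) (q : P.obj B) :
    P.comp p (P.map f q) = P.map (Equiv.sumCongr (Equiv.refl A) f) (P.comp p q) := by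
  rw [← P.comp_map, P.map_id (e := (Equiv.refl A).optionCongr) (by simp)]

theorem comp_one_eq {A : Type} [Finite A] (p : P.obj (Option A)) :
    P.comp p P.one = P.map (sumUnit A).symm p :=
  P.eq_map_symm (P.comp_one p)

theorem comp₂_map (e : P.obj (Fin 2)) {A A' B B' : Type} [Finite A] [Finite A'] [Finite B]
    [Finite B'] (f : A ≃ A') (g : B ≃ B') (p : P.obj A) (q : P.obj B) :
    P.comp₂ e (P.map f p) (P.map g q) = P.map (Equiv.sumCongr f g) (P.comp₂ e p q) := by
  have h : P.map (unitSum A') (P.comp (P.map finTwoOption e) (P.map f p)) =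
      P.map f.optionCongr (P.map (unitSum A) (P.comp (P.map finTwoOption e) p)) := by
    rw [P.comp_map_right, P.map_map, P.map_map]
    apply P.map_congr
    rintro (a | a) <;> rfl
  rw [comp₂, comp₂, h, P.comp_map]

theorem comp₂_comp_right (e : P.obj (Fin 2)) {A B C : Type} [Finite A] [Finite B] [Finite C]
    (p : P.obj A) (q : P.obj (Option B)) (s : P.obj C) :
    P.comp₂ e p (P.comp q s) =
      P.map (Equiv.sumAssoc A B C) (P.comp (P.map (sumOption A B) (P.comp₂ e p q)) s) :=
  (P.comp_assoc _ _ _).symm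

/-- The parallel axiom moves the insertion of `s` in front of that of `q`; the sequential axiom then
turns it into an insertion into `p`. -/
theorem comp₂_comp_left (e : P.obj (Fin 2)) {A B C : Type} [Finite A] [Finite B] [Finite C]
    (p : P.obj (Option A)) (q : P.obj B) (s : P.obj C) :
    P.comp₂ e (P.comp p s) q =
      P.map (sumRightComm A B C) (P.comp (P.map (optionSum A B) (P.comp₂ e p q)) s) := by
  rw [comp₂, comp₂, P.comp_comm, ← P.comp_assoc, P.map_map, P.map_map]
  congr 2
  have h : P.map ((unitSum (Option A)).trans (optionSwap A)) (P.comp (P.map finTwoOption e) p) =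
      P.map (unitSum A).optionCongr (P.map (sumOption Unit A)
        (P.comp (P.map finTwoOption e) p)) := by
    rw [P.map_map]
    apply P.map_congr
    rintro (_ | _ | a) <;> rfl
  rw [h, P.comp_map_left, P.map_map]
  apply P.map_congr
  rintro ((_ | a) | a) <;> rfl

theorem comp₂_one_one (e : P.obj (Fin 2)) (f : Unit ⊕ Unit ≃ Fin 2) (h : f (.inl ()) = 0)
    (h' : f (.inr ()) = 1) : P.map f (P.comp₂ e P.one P.one) = e := by
  rw [comp₂, P.comp_one_eq, P.comp_one_eq, P.map_map, P.map_map, P.map_map, P.map_map, P.map_id]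
  intro i
  fin_cases i
  · exact h
  · exact h'

variable {G : Type w} (φ : G → P.obj (Fin 2))

/-- The leaf types of `t` and `t.bind f` are different, so a bijection compatible with labels is
produced along the induction. Only the values of `f` at labels occurring in `t` are constrained,
which lets the lemma apply to a subtree that avoids a marked leaf. -/
theorem exists_termValue_bind_var {X Y : Type} (t : BinTerm G X) (f : X → BinTerm G Y)
    (y : t.Leaf → Y) (hf : ∀ i, f (t.label i) = .var (y i)) :
    ∃ η : t.Leaf ≃ (t.bind f).Leaf, (∀ i, (t.bind f).label (η i) = y i) ∧
      P.termValue φ (t.bind f) = P.map η (P.termValue φ t) := by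
  induction t with
  | var x =>
    have h : f x = .var (y ()) := hf ()
    change ∃ η : Unit ≃ (f x).Leaf, (∀ i, (f x).label (η i) = y i) ∧
      P.termValue φ (f x) = P.map η P.one
    rw [h]
    exact ⟨Equiv.refl _, fun _ => rfl, (P.map_refl _).symm⟩
  | node g l r hl hr =>
    obtain ⟨a, ha, ha'⟩ := hl (fun i => y (.inl i)) (fun i => hf (.inl i))
    obtain ⟨b, hb, hb'⟩ := hr (fun i => y (.inr i)) (fun i => hf (.inr i))
    refine ⟨Equiv.sumCongr a b, ?_, ?_⟩
    · rintro (i | i)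
      · exact ha i
      · exact hb i
    · refine Eq.trans ?_ (P.comp₂_map (φ g) a b (P.termValue φ l) (P.termValue φ r))
      rw [← ha', ← hb']
      rfl

theorem exists_eq_optionCongr {A B : Type} (e : Option A ≃ Option B) (h : e none = none) :
    ∃ δ : A ≃ B, e = δ.optionCongr := by
  refine ⟨Equiv.removeNone e, Equiv.ext ?_⟩
  rintro (_ | a)
  · simpa using h
  · refine (Equiv.removeNone_some e (Option.ne_none_iff_exists'.1 fun ha => ?_)).symm
    simpa using e.injective (ha.trans h.symm)

/-- This is `comp₂_comp_left` up to relabelling, for a marked input in the left factor: `e'` singles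
it out in that factor, `e` in the whole product, and `δ` matches the remaining inputs. -/
theorem comp_map_comp₂_left (g : P.obj (Fin 2)) {A B B' C D : Type} [Finite A] [Finite B]
    [Finite B'] [Finite C] [Finite D] (p : P.obj B) (q : P.obj C) (s : P.obj D)
    (e : B ⊕ C ≃ Option A) (e' : B ≃ Option B') (δ : B' ⊕ C ≃ A)
    (h : ((Equiv.sumCongr e' (Equiv.refl C)).trans (optionSum B' C)).symm.trans e =
      δ.optionCongr) :
    P.comp₂ g (P.comp (P.map e' p) s) q =
      P.map ((Equiv.sumCongr δ (Equiv.refl D)).symm.trans (sumRightComm B' C D))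
        (P.comp (P.map e (P.comp₂ g p q)) s) := by
  have he : e = ((Equiv.sumCongr e' (Equiv.refl C)).trans (optionSum B' C)).trans
      δ.optionCongr := by
    rw [← h]
    ext x
    simp
  have hc : P.comp₂ g (P.map e' p) q = P.map (e'.sumCongr (Equiv.refl C)) (P.comp₂ g p q) := by
    rw [← P.comp₂_map, P.map_refl]
  rw [P.comp₂_comp_left, hc, he, P.map_trans _ δ.optionCongr, P.comp_map_left, P.map_map, P.map_map]
  apply P.map_congr
  simp

theorem comp_map_comp₂_right (g : P.obj (Fin 2)) {A B C C' D : Type} [Finite A] [Finite B]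
    [Finite C] [Finite C'] [Finite D] (p : P.obj B) (q : P.obj C) (s : P.obj D)
    (e : B ⊕ C ≃ Option A) (e' : C ≃ Option C') (δ : B ⊕ C' ≃ A)
    (h : ((Equiv.sumCongr (Equiv.refl B) e').trans (sumOption B C')).symm.trans e =
      δ.optionCongr) :
    P.comp₂ g p (P.comp (P.map e' q) s) =
      P.map ((Equiv.sumCongr δ (Equiv.refl D)).symm.trans (Equiv.sumAssoc B C' D))
        (P.comp (P.map e (P.comp₂ g p q)) s) := by
  have he : e = ((Equiv.sumCongr (Equiv.refl B) e').trans (sumOption B C')).trans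
      δ.optionCongr := by
    rw [← h]
    ext x
    simp
  have hc : P.comp₂ g p (P.map e' q) = P.map ((Equiv.refl B).sumCongr e') (P.comp₂ g p q) := by
    rw [← P.comp₂_map, P.map_refl]
  rw [P.comp₂_comp_right, hc, he, P.map_trans _ δ.optionCongr, P.comp_map_left, P.map_map, P.map_map]
  apply P.map_congr
  simp

/-- Grafting `s` at one marked leaf, namely `e.symm none`, is evaluated by the operadic composition.
The induction follows the path from the root to that leaf; at each node the subtree off the path
only has its variables renamed. The set `A` of other leaves changes with the subtree, hence it is
generalized. -/
theorem exists_termValue_bind {X Y : Type} (t : BinTerm G X) {A : Type} [Finite A]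
    (e : t.Leaf ≃ Option A) (f : X → BinTerm G Y) (s : BinTerm G Y) (y : A → Y)
    (hs : f (t.label (e.symm none)) = s) (hy : ∀ a, f (t.label (e.symm (some a))) = .var (y a)) :
    ∃ η : A ⊕ s.Leaf ≃ (t.bind f).Leaf, (∀ z, (t.bind f).label (η z) = Sum.elim y s.label z) ∧
      P.termValue φ (t.bind f) =
        P.map η (P.comp (P.map e (P.termValue φ t)) (P.termValue φ s)) := by
  classical
  induction t generalizing A with
  | var x =>
    have h : f x = s := hs
    subst h
    -- The only leaf is the marked one, so no further input remains and the left unit axiom applies.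
    have : IsEmpty A := ⟨fun a => by
      have h : e.symm (some a) = e.symm none := rfl
      simpa using e.symm.injective h⟩
    refine ⟨Equiv.emptySum A _, ?_, ?_⟩
    · rintro (a | i)
      · exact isEmptyElim a
      · rfl
    · have h : P.map e (P.termValue φ (.var x)) =
          P.map (Equiv.equivOfIsEmpty Empty A).optionCongr (P.map unitOption P.one) := by
        rw [P.map_map]
        apply P.map_congr
        intro i
        rcases h : e i with _ | a
        · rfl
        · exact isEmptyElim a
      rw [h, P.comp_map_left]
      refine (P.one_comp (P.termValue φ (f x))).symm.trans ?_
      refine Eq.trans ?_ (P.map_map _ _ _).symm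
      apply P.map_congr
      rintro (a | i)
      · exact a.elim
      · rfl
  | node g l r hl hr =>
    change l.Leaf ⊕ r.Leaf ≃ Option A at e
    change f (Sum.elim l.label r.label (e.symm none)) = s at hs
    change ∀ a, f (Sum.elim l.label r.label (e.symm (some a))) = .var (y a) at hy
    rcases hi : e.symm none with i | i
    -- The marked leaf `i` lies in `l`. The remaining leaves of `l` are taken as a subtype, and `δ`
    -- compares them, together with the leaves of `r`, with `A`.
    · obtain ⟨e', he'⟩ : ∃ e' : l.Leaf ≃ Option {x // x ≠ i}, e'.symm none = i :=
        ⟨(Equiv.optionSubtypeNe i).symm, rfl⟩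
      obtain ⟨δ, hδ⟩ := exists_eq_optionCongr (((Equiv.sumCongr e' (Equiv.refl r.Leaf)).trans
        (optionSum _ r.Leaf)).symm.trans e) (by
          rw [Equiv.trans_apply, ← Equiv.eq_symm_apply, hi]
          exact congrArg Sum.inl he')
      have hδ' : ∀ z, e.symm (some (δ z)) = ((Equiv.sumCongr e' (Equiv.refl r.Leaf)).trans
          (optionSum _ r.Leaf)).symm (some z) := by
        intro z
        rw [Equiv.symm_apply_eq]
        exact (Equiv.congr_fun hδ (some z)).symm
      obtain ⟨a, ha, ha'⟩ := hl e' (fun z => y (δ (.inl z))) (by rw [← hs, hi, he']; rfl)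
        (fun z => by rw [← hy, hδ']; rfl)
      obtain ⟨b, hb, hb'⟩ := P.exists_termValue_bind_var φ r f (fun z => y (δ (.inr z)))
        (fun z => by rw [← hy, hδ']; rfl)
      refine ⟨((Equiv.sumCongr δ (Equiv.refl s.Leaf)).symm.trans
        (sumRightComm _ r.Leaf s.Leaf)).trans (Equiv.sumCongr a b), ?_, ?_⟩
      · rintro (z | z)
        · obtain ⟨z | z, rfl⟩ := δ.surjective z
          · change Sum.elim (l.bind f).label (r.bind f).label (Sum.map a b (sumRightComm _ _ _
              (Sum.map δ.symm id (Sum.inl (δ (.inl z)))))) = _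
            rw [Sum.map_inl, Equiv.symm_apply_apply]
            exact ha (.inl z)
          · change Sum.elim (l.bind f).label (r.bind f).label (Sum.map a b (sumRightComm _ _ _
              (Sum.map δ.symm id (Sum.inl (δ (.inr z)))))) = _
            rw [Sum.map_inl, Equiv.symm_apply_apply]
            exact hb z
        · exact ha (.inr z)
      · refine Eq.trans ?_ (P.map_map _ _ _)
        refine Eq.trans ?_ (congrArg (P.map (Equiv.sumCongr a b))
          (P.comp_map_comp₂_left (φ g) _ (P.termValue φ r) _ e e' δ hδ))
        rw [← P.comp₂_map, ← ha', ← hb']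
        rfl
    · obtain ⟨e', he'⟩ : ∃ e' : r.Leaf ≃ Option {x // x ≠ i}, e'.symm none = i :=
        ⟨(Equiv.optionSubtypeNe i).symm, rfl⟩
      obtain ⟨δ, hδ⟩ := exists_eq_optionCongr (((Equiv.sumCongr (Equiv.refl l.Leaf) e').trans
        (sumOption l.Leaf _)).symm.trans e) (by
          rw [Equiv.trans_apply, ← Equiv.eq_symm_apply, hi]
          exact congrArg Sum.inr he')
      have hδ' : ∀ z, e.symm (some (δ z)) = ((Equiv.sumCongr (Equiv.refl l.Leaf) e').trans
          (sumOption l.Leaf _)).symm (some z) := by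
        intro z
        rw [Equiv.symm_apply_eq]
        exact (Equiv.congr_fun hδ (some z)).symm
      obtain ⟨a, ha, ha'⟩ := hr e' (fun z => y (δ (.inr z))) (by rw [← hs, hi, he']; rfl)
        (fun z => by rw [← hy, hδ']; rfl)
      obtain ⟨b, hb, hb'⟩ := P.exists_termValue_bind_var φ l f (fun z => y (δ (.inl z)))
        (fun z => by rw [← hy, hδ']; rfl)
      refine ⟨((Equiv.sumCongr δ (Equiv.refl s.Leaf)).symm.trans
        (Equiv.sumAssoc l.Leaf _ s.Leaf)).trans (Equiv.sumCongr b a), ?_, ?_⟩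
      · rintro (z | z)
        · obtain ⟨z | z, rfl⟩ := δ.surjective z
          · change Sum.elim (l.bind f).label (r.bind f).label (Sum.map b a (Equiv.sumAssoc _ _ _
              (Sum.map δ.symm id (Sum.inl (δ (.inl z)))))) = _
            rw [Sum.map_inl, Equiv.symm_apply_apply]
            exact hb z
          · change Sum.elim (l.bind f).label (r.bind f).label (Sum.map b a (Equiv.sumAssoc _ _ _
              (Sum.map δ.symm id (Sum.inl (δ (.inr z)))))) = _
            rw [Sum.map_inl, Equiv.symm_apply_apply]
            exact ha (.inl z)
        · exact ha (.inr z)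
      · refine Eq.trans ?_ (P.map_map _ _ _)
        refine Eq.trans ?_ (congrArg (P.map (Equiv.sumCongr b a))
          (P.comp_map_comp₂_right (φ g) (P.termValue φ l) _ _ e e' δ hδ))
        rw [← P.comp₂_map, ← ha', ← hb']
        rfl

theorem lift_term {A : Type} [Finite A] (t : MTerm G A) :
    P.lift φ A (magmaticTerm k t) =
      P.map (Equiv.ofBijective t.1.label t.2) (P.termValue φ t.1) := by
  simp only [lift]
  refine (Finsupp.sum_single_index ?_).trans ?_
  · exact zero_smul k _
  · exact one_smul k _

theorem lift_map_single {A B : Type} [Finite A] [Finite B] (e : A ≃ B) (t : MTerm G A) :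
    P.map (Equiv.ofBijective (t.map e).1.label (t.map e).2) (P.termValue φ (t.map e).1) =
      P.map e (P.map (Equiv.ofBijective t.1.label t.2) (P.termValue φ t.1)) := by
  obtain ⟨η, h, h'⟩ := P.exists_termValue_bind_var φ t.1 (fun x => .var (e x))
    (fun i => e (t.1.label i)) (fun _ => rfl)
  refine (congrArg _ h').trans ?_
  rw [P.map_map]
  refine (P.map_map _ _ _).trans (P.map_congr ?_ _)
  exact h

/-- Insertion substitutes a renamed copy of `s` for the variable `none` and variables elsewhere. By
multilinearity exactly one leaf of `t` carries `none`, so `exists_termValue_bind` applies with that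
leaf marked. -/
theorem lift_insert_single {A B : Type} [Finite A] [Finite B] (t : MTerm G (Option A))
    (s : MTerm G B) :
    P.map (Equiv.ofBijective (t.insert s).1.label (t.insert s).2)
        (P.termValue φ (t.insert s).1) =
      P.comp (P.map (Equiv.ofBijective t.1.label t.2) (P.termValue φ t.1))
        (P.map (Equiv.ofBijective s.1.label s.2) (P.termValue φ s.1)) := by
  obtain ⟨ξ, hξ, hξ'⟩ : ∃ ξ : s.1.Leaf ≃ (s.1.rename (Sum.inr : B → A ⊕ B)).Leaf,
      (∀ i, (s.1.rename (Sum.inr : B → A ⊕ B)).label (ξ i) = .inr (s.1.label i)) ∧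
        P.termValue φ (s.1.rename (Sum.inr : B → A ⊕ B)) = P.map ξ (P.termValue φ s.1) :=
    P.exists_termValue_bind_var φ s.1 _ _ (fun _ => rfl)
  obtain ⟨η, h, h'⟩ : ∃ η : A ⊕ (s.1.rename (Sum.inr : B → A ⊕ B)).Leaf ≃ (t.insert s).1.Leaf,
      (∀ z, (t.insert s).1.label (η z) =
        Sum.elim Sum.inl (s.1.rename (Sum.inr : B → A ⊕ B)).label z) ∧
      P.termValue φ (t.insert s).1 =
        P.map η (P.comp (P.map (Equiv.ofBijective t.1.label t.2) (P.termValue φ t.1))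
          (P.termValue φ (s.1.rename (Sum.inr : B → A ⊕ B)))) :=
    P.exists_termValue_bind φ t.1 (Equiv.ofBijective t.1.label t.2) _ _ _
      (by rw [Equiv.ofBijective_apply_symm_apply t.1.label t.2]; rfl)
      (fun a => by rw [Equiv.ofBijective_apply_symm_apply t.1.label t.2]; rfl)
  rw [h', hξ', P.comp_map_right, P.comp_map_right, P.map_map, P.map_map]
  apply P.map_congr
  rintro (a | i)
  · exact h (.inl a)
  · exact (h (.inr (ξ i))).trans (hξ i)

/-- The morphism from the free operad which is given by the images of the generators. -/
def liftHom : (magmatic k G).Hom P where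
  app A _ := P.lift φ A
  app_map {A B} _ _ e p := by
    revert p
    refine LinearMap.congr_fun (f := P.lift φ B ∘ₗ (magmatic k G).map e)
      (g := P.map e ∘ₗ P.lift φ A) (magmatic_linearMap_ext fun t => ?_)
    rw [LinearMap.comp_apply, LinearMap.comp_apply, magmatic_map_term, lift_term, lift_term,
      lift_map_single]
  app_comp {A B} _ _ p q := by
    revert q
    refine LinearMap.congr_fun (f := P.lift φ _ ∘ₗ (magmatic k G).comp p)
      (g := P.comp (P.lift φ _ p) ∘ₗ P.lift φ B) (magmatic_linearMap_ext fun s => ?_)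
    revert p
    refine LinearMap.congr_fun
      (f := P.lift φ _ ∘ₗ (magmatic k G).comp.flip (magmaticTerm k s))
      (g := P.comp.flip (P.lift φ _ (magmaticTerm k s)) ∘ₗ P.lift φ _)
      (magmatic_linearMap_ext fun t => ?_)
    rw [LinearMap.comp_apply, LinearMap.comp_apply, LinearMap.flip_apply, LinearMap.flip_apply,
      magmatic_comp_term, lift_term, lift_term, lift_term, lift_insert_single]
  app_one := (P.lift_term φ _).trans (P.map_id (fun _ => rfl) _)

end SymOperad

/-- A generator of the free operad, as an operation. -/
def magmaticGen (k : Type u) [Field k] {G : Type w} (g : G) : (magmatic k G).obj (Fin 2) :=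
  mono k (.node g (.var 0) (.var 1)) (isMultilinear_mul g)

theorem SymOperad.liftHom_magmaticGen (P : SymOperad.{u, v} k) {G : Type w}
    (φ : G → P.obj (Fin 2)) (g : G) : (P.liftHom φ).app _ (magmaticGen k g) = φ g :=
  (P.lift_term φ _).trans (P.comp₂_one_one (φ g) _ rfl rfl)

/-! ### Morphisms out of the free operad are determined by the generators -/

namespace BinTerm

/-- A monomial with its leaves as variables. -/
def onLeaves {G : Type v} {X : Type} : (t : BinTerm G X) → BinTerm G t.Leaf
  | .var _ => .var ()
  | .node g l r => .node g (l.onLeaves.rename Sum.inl) (r.onLeaves.rename Sum.inr)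

theorem rename_label_onLeaves {G : Type v} {X : Type} (t : BinTerm G X) :
    t.onLeaves.rename t.label = t := by
  induction t with
  | var x => rfl
  | node g l r hl hr =>
    have h1 : (l.onLeaves.rename .inl).rename (Sum.elim l.label r.label) = l := by
      refine (bind_bind _ _ _).trans hl
    have h2 : (r.onLeaves.rename .inr).rename (Sum.elim l.label r.label) = r := by
      refine (bind_bind _ _ _).trans hr
    exact congrArg₂ (node g) h1 h2

end BinTerm

/-- Multilinearity of the explicit monomial is part of the conclusion: it is inherited from the
insertions that produce it. -/
theorem magmatic_comp₂_gen {G : Type w} (g : G) {A B : Type} [Finite A] [Finite B]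
    (p : MTerm G A) (q : MTerm G B) :
    ∃ h : (BinTerm.node g (p.1.rename (Sum.inl : A → A ⊕ B))
        (q.1.rename (Sum.inr : B → A ⊕ B))).IsMultilinear,
      (magmatic k G).comp₂ (magmaticGen k g) (magmaticTerm k p) (magmaticTerm k q) =
        magmaticTerm k ⟨_, h⟩ := by
  have h : ∃ t : MTerm G (A ⊕ B),
      (magmatic k G).comp₂ (magmaticGen k g) (magmaticTerm k p) (magmaticTerm k q) =
        magmaticTerm k t ∧ t.1 = .node g (p.1.rename (Sum.inl : A → A ⊕ B))
          (q.1.rename (Sum.inr : B → A ⊕ B)) := by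
    refine ⟨MTerm.insert (MTerm.map (unitSum A) (MTerm.insert
      (MTerm.map finTwoOption ⟨_, isMultilinear_mul g⟩) p)) q, ?_, ?_⟩
    · simp only [SymOperad.comp₂, magmaticGen, mono]
      rw [← magmaticTerm.eq_1, magmatic_map_term, magmatic_comp_term, magmatic_map_term,
        magmatic_comp_term]
    · refine congrArg₂ (BinTerm.node g) ?_ rfl
      change ((p.1.bind (fun x => .var (Sum.inr x))).bind (fun x => .var (unitSum A x))).bind _ =
        p.1.bind _
      rw [BinTerm.bind_bind, BinTerm.bind_bind]
      rfl
  obtain ⟨⟨t, ht⟩, h, rfl⟩ := h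
  exact ⟨ht, h⟩

theorem magmatic_termValue {G : Type w} {X : Type} (t : BinTerm G X) :
    ∃ h : t.onLeaves.IsMultilinear,
      (magmatic k G).termValue (magmaticGen k) t = magmaticTerm k ⟨t.onLeaves, h⟩ := by
  induction t with
  | var x => exact ⟨_, rfl⟩
  | node g l r hl hr =>
    obtain ⟨hl, hl'⟩ := hl
    obtain ⟨hr, hr'⟩ := hr
    obtain ⟨h, h'⟩ := magmatic_comp₂_gen (k := k) g ⟨l.onLeaves, hl⟩ ⟨r.onLeaves, hr⟩
    refine ⟨h, Eq.trans ?_ h'⟩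
    rw [← hl', ← hr']
    rfl

theorem SymOperad.Hom.app_termValue {P : SymOperad.{u, v} k} {Q : SymOperad.{u, w} k}
    (f : P.Hom Q) {G : Type*} (φ : G → P.obj (Fin 2)) {X : Type} (t : BinTerm G X) :
    f.app _ (P.termValue φ t) = Q.termValue (fun g => f.app _ (φ g)) t := by
  induction t with
  | var x => exact f.app_one
  | node g l r hl hr =>
    refine (f.app_comp₂ _ _ _).trans ?_
    rw [hl, hr]
    rfl

/-- The generators generate: every monomial is obtained from them by compositions and a renaming of
the leaves, operations that any morphism preserves. -/
theorem magmaticTerm_eq {G : Type w} {A : Type} [Finite A] (t : MTerm G A) :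
    magmaticTerm k t =
      (magmatic k G).map (Equiv.ofBijective t.1.label t.2)
        ((magmatic k G).termValue (magmaticGen k) t.1) := by
  obtain ⟨h, h'⟩ := magmatic_termValue (k := k) t.1
  rw [h', magmatic_map_term]
  congr 1
  exact Subtype.ext t.1.rename_label_onLeaves.symm

theorem SymOperad.Hom.magmatic_ext {G : Type w} {Q : SymOperad.{u, v} k}
    (f f' : (magmatic k G).Hom Q)
    (h : ∀ g, f.app _ (magmaticGen k g) = f'.app _ (magmaticGen k g)) (A : Type) [Finite A]
    (p : (magmatic k G).obj A) : f.app A p = f'.app A p := by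
  revert p
  refine LinearMap.congr_fun (magmatic_linearMap_ext fun t => ?_)
  rw [magmaticTerm_eq, f.app_map, f'.app_map, f.app_termValue, f'.app_termValue, funext h]

/-! ### Compositions of two binary operations -/

/-- `(* ⊔ {0, 1}) ≃ {0, 1, 2}`, where `*` is sent to `2`. -/
def unitSumFinTwoLeft : Unit ⊕ Fin 2 ≃ Fin 3 where
  toFun := Sum.elim (fun _ => 2) Fin.castSucc
  invFun i := ![.inr 0, .inr 1, .inl ()] i
  left_inv := by rintro (_ | i); · rfl
                 fin_cases i <;> rfl
  right_inv := by decide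

/-- `(* ⊔ {0, 1}) ≃ {0, 1, 2}`, where `*` is sent to `0`. -/
def unitSumFinTwoRight : Unit ⊕ Fin 2 ≃ Fin 3 where
  toFun := Sum.elim (fun _ => 0) Fin.succ
  invFun i := ![.inl (), .inr 0, .inr 1] i
  left_inv := by rintro (_ | i); · rfl
                 fin_cases i <;> rfl
  right_inv := by decide

namespace SymOperad

variable (P : SymOperad.{u, v} k)

/-- The operation `a (b (x₁, x₂), x₃)`. -/
def compL : P.obj (Fin 2) →ₗ[k] P.obj (Fin 2) →ₗ[k] P.obj (Fin 3) :=
  (P.comp ∘ₗ P.map finTwoOption).compr₂ (P.map unitSumFinTwoLeft)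

/-- The operation `a (x₁, b (x₂, x₃))`. -/
def compR : P.obj (Fin 2) →ₗ[k] P.obj (Fin 2) →ₗ[k] P.obj (Fin 3) :=
  (P.comp ∘ₗ P.map finTwoOption ∘ₗ P.flip).compr₂ (P.map unitSumFinTwoRight)

theorem compL_apply (a b : P.obj (Fin 2)) :
    P.compL a b = P.map unitSumFinTwoLeft (P.comp (P.map finTwoOption a) b) := rfl

theorem compR_apply (a b : P.obj (Fin 2)) :
    P.compR a b = P.map unitSumFinTwoRight (P.comp (P.map finTwoOption (P.flip a)) b) := rfl

theorem flip_flip (a : P.obj (Fin 2)) : P.flip (P.flip a) = a := by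
  rw [flip, P.map_map, P.map_id]
  simp

theorem compL_flip_right (a b : P.obj (Fin 2)) :
    P.compL a (P.flip b) = P.map (Equiv.swap 0 1) (P.compL a b) := by
  rw [compL_apply, compL_apply, flip, P.comp_map_right, P.map_map, P.map_map]
  apply P.map_congr
  rintro (i | i)
  · rfl
  · fin_cases i <;> rfl

theorem compR_flip_right (a b : P.obj (Fin 2)) :
    P.compR a (P.flip b) = P.map (Equiv.swap 1 2) (P.compR a b) := by
  have h : P.comp (P.map finTwoOption (P.flip a)) (P.flip b) =
      P.map (Equiv.sumCongr (Equiv.refl Unit) (Equiv.swap 0 1))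
        (P.comp (P.map finTwoOption (P.flip a)) b) := P.comp_map_right _ _ _
  rw [compR_apply, compR_apply, h, P.map_map, P.map_map]
  apply P.map_congr
  rintro (i | i)
  · rfl
  · fin_cases i <;> rfl

/-- `compR` is defined by flipping the outer operation and inserting in its first slot. The two
flips cancel, so both sides are the same insertion with differently numbered inputs. -/
theorem compR_flip_left (a b : P.obj (Fin 2)) :
    P.compR (P.flip a) b = P.map (finRotate 3) (P.compL a b) := by
  rw [compR_apply, compL_apply, flip_flip, P.map_map]
  apply P.map_congr
  rintro (i | i)
  · rfl
  · fin_cases i <;> rfl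

theorem compL_flip_left (a b : P.obj (Fin 2)) :
    P.compL (P.flip a) b = P.map (finRotate 3).symm (P.compR a b) := by
  rw [compR_apply, compL_apply, P.map_map]
  apply P.map_congr
  rintro (i | i)
  · rfl
  · fin_cases i <;> rfl

theorem compR_flip_flip (a b : P.obj (Fin 2)) :
    P.compR (P.flip a) (P.flip b) = P.map (Equiv.swap 0 2) (P.compL a b) := by
  rw [compR_flip_right, compR_flip_left, P.map_map]
  apply P.map_congr
  decide

theorem compL_flip_flip (a b : P.obj (Fin 2)) :
    P.compL (P.flip a) (P.flip b) = P.map (Equiv.swap 0 2) (P.compR a b) := by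
  rw [compL_flip_right, compL_flip_left, P.map_map]
  apply P.map_congr
  decide

theorem Hom.app_flip {P : SymOperad.{u, v} k} {Q : SymOperad.{u, w} k} (f : P.Hom Q)
    (a : P.obj (Fin 2)) : f.app _ (P.flip a) = Q.flip (f.app _ a) :=
  f.app_map _ _

theorem Hom.app_compL {P : SymOperad.{u, v} k} {Q : SymOperad.{u, w} k} (f : P.Hom Q)
    (a b : P.obj (Fin 2)) : f.app _ (P.compL a b) = Q.compL (f.app _ a) (f.app _ b) := by
  rw [compL_apply, compL_apply, f.app_map, f.app_comp, f.app_map]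

theorem Hom.app_compR {P : SymOperad.{u, v} k} {Q : SymOperad.{u, w} k} (f : P.Hom Q)
    (a b : P.obj (Fin 2)) : f.app _ (P.compR a b) = Q.compR (f.app _ a) (f.app _ b) := by
  rw [compR_apply, compR_apply, f.app_map, f.app_comp, f.app_map, f.app_flip]

/-! ### Hadamard products -/

variable (Q : SymOperad.{u, w} k)

/-- The tensor product of two operations. -/
def tmul {A : Type} [Finite A] : P.obj A →ₗ[k] Q.obj A →ₗ[k] (P.hadamard Q).obj A :=
  TensorProduct.mk k (P.obj A) (Q.obj A)

theorem tmul_ext {P : SymOperad.{u, v} k} {Q : SymOperad.{u, w} k} {A : Type}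
    [Finite A] {M : Type*} [AddCommGroup M] [Module k M] {f g : (P.hadamard Q).obj A →ₗ[k] M}
    (h : ∀ a b, f (P.tmul Q a b) = g (P.tmul Q a b)) : f = g :=
  TensorProduct.ext' h

theorem map_tmul {A B : Type} [Finite A] [Finite B] (e : A ≃ B) (a : P.obj A) (b : Q.obj A) :
    (P.hadamard Q).map e (P.tmul Q a b) = P.tmul Q (P.map e a) (Q.map e b) :=
  rfl

theorem flip_tmul (a : P.obj (Fin 2)) (b : Q.obj (Fin 2)) :
    (P.hadamard Q).flip (P.tmul Q a b) = P.tmul Q (P.flip a) (Q.flip b) :=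
  rfl

theorem compL_tmul (a a' : P.obj (Fin 2)) (b b' : Q.obj (Fin 2)) :
    (P.hadamard Q).compL (P.tmul Q a b) (P.tmul Q a' b') =
      P.tmul Q (P.compL a a') (Q.compL b b') :=
  rfl

theorem compR_tmul (a a' : P.obj (Fin 2)) (b b' : Q.obj (Fin 2)) :
    (P.hadamard Q).compR (P.tmul Q a b) (P.tmul Q a' b') =
      P.tmul Q (P.compR a a') (Q.compR b b') :=
  rfl

end SymOperad

/-! ### Monomials of small degree -/

namespace BinTerm

variable {G : Type v} {X : Type}

theorem card_leaf_node (g : G) (l r : BinTerm G X) :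
    Nat.card (node g l r).Leaf = Nat.card l.Leaf + Nat.card r.Leaf :=
  Nat.card_sum (α := l.Leaf) (β := r.Leaf)

theorem card_leaf_var (x : X) : Nat.card (var x : BinTerm G X).Leaf = 1 :=
  Nat.card_unique (α := Unit)

theorem card_leaf_pos (t : BinTerm G X) : 0 < Nat.card t.Leaf := by
  induction t with
  | var x => rw [card_leaf_var]; exact one_pos
  | node g l r hl hr => rw [card_leaf_node]; omega

theorem exists_eq_of_card_leaf_eq_one (t : BinTerm G X) (h : Nat.card t.Leaf = 1) :
    ∃ x, t = var x := by
  cases t with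
  | var x => exact ⟨x, rfl⟩
  | node g l r =>
    rw [card_leaf_node] at h
    have := l.card_leaf_pos
    have := r.card_leaf_pos
    omega

theorem exists_eq_of_card_leaf_eq_two (t : BinTerm G X) (h : Nat.card t.Leaf = 2) :
    ∃ g x y, t = node g (var x) (var y) := by
  cases t with
  | var x => rw [card_leaf_var] at h; omega
  | node g l r =>
    rw [card_leaf_node] at h
    have := l.card_leaf_pos
    have := r.card_leaf_pos
    obtain ⟨x, rfl⟩ := l.exists_eq_of_card_leaf_eq_one (by omega)
    obtain ⟨y, rfl⟩ := r.exists_eq_of_card_leaf_eq_one (by omega)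
    exact ⟨g, x, y, rfl⟩

theorem exists_eq_of_card_leaf_eq_three (t : BinTerm G X) (h : Nat.card t.Leaf = 3) :
    ∃ (g g' : G) (x : Fin 3 → X), t = node g (node g' (var (x 0)) (var (x 1))) (var (x 2)) ∨
      t = node g (var (x 0)) (node g' (var (x 1)) (var (x 2))) := by
  cases t with
  | var x => rw [card_leaf_var] at h; omega
  | node g l r =>
    rw [card_leaf_node] at h
    have := l.card_leaf_pos
    have := r.card_leaf_pos
    obtain h' | h' : Nat.card l.Leaf = 1 ∨ Nat.card l.Leaf = 2 := by omega
    · obtain ⟨x, rfl⟩ := l.exists_eq_of_card_leaf_eq_one h'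
      obtain ⟨g', y, z, rfl⟩ := r.exists_eq_of_card_leaf_eq_two (by omega)
      exact ⟨g, g', ![x, y, z], .inr rfl⟩
    · obtain ⟨g', x, y, rfl⟩ := l.exists_eq_of_card_leaf_eq_two h'
      obtain ⟨z, rfl⟩ := r.exists_eq_of_card_leaf_eq_one (by omega)
      exact ⟨g, g', ![x, y, z], .inl rfl⟩

theorem IsMultilinear.card_leaf {t : BinTerm G X} (ht : t.IsMultilinear) :
    Nat.card t.Leaf = Nat.card X :=
  Nat.card_congr (Equiv.ofBijective _ ht)

end BinTerm

theorem magmaticTerm_eq_mono {G : Type w} {A : Type} [Finite A] (t : BinTerm G A)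
    (ht : t.IsMultilinear) : magmaticTerm k ⟨t, ht⟩ = mono k t ht := rfl

theorem magmatic_mem {G : Type w} {A : Type} [Finite A] (N : Submodule k ((magmatic k G).obj A))
    (h : ∀ t, magmaticTerm k t ∈ N) (p : (magmatic k G).obj A) : p ∈ N := by
  have h : N.mkQ = 0 := magmatic_linearMap_ext fun t =>
    (Submodule.Quotient.mk_eq_zero N).2 (h t)
  rw [← N.ker_mkQ, LinearMap.mem_ker, h, LinearMap.zero_apply]

theorem magmaticTerm_eq_map_one {G : Type w} {A : Type} [Finite A] (t : MTerm G A)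
    (h : Nat.card A = 1) : ∃ e : Unit ≃ A, magmaticTerm k t = (magmatic k G).map e
      (magmatic k G).one := by
  obtain ⟨t, ht⟩ := t
  obtain ⟨x, rfl⟩ := t.exists_eq_of_card_leaf_eq_one (ht.card_leaf.trans h)
  exact ⟨Equiv.ofBijective _ ht, (magmatic_map_term (Equiv.ofBijective _ ht)
    ⟨.var (), Function.bijective_id⟩).symm⟩

theorem magmaticTerm_two {G : Type w} (t : MTerm G (Fin 2)) :
    ∃ g : G, magmaticTerm k t = magmaticGen k g ∨
      magmaticTerm k t = (magmatic k G).flip (magmaticGen k g) := by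
  obtain ⟨t, ht⟩ := t
  obtain ⟨g, x, y, rfl⟩ := t.exists_eq_of_card_leaf_eq_two (ht.card_leaf.trans (by simp))
  have h : x ≠ y := fun h => by
    have := ht.1 (a₁ := .inl ()) (a₂ := .inr ()) h
    cases this
  refine ⟨g, ?_⟩
  have h' : (magmatic k G).flip (magmaticGen k g) = _ :=
    magmatic_map_term (Equiv.swap 0 1) ⟨_, isMultilinear_mul g⟩
  rw [h']
  fin_cases x <;> fin_cases y
  · exact absurd rfl h
  · exact .inl rfl
  · exact .inr rfl
  · exact absurd rfl h

theorem magmatic_compL_gen {G : Type w} (g g' : G) :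
    ∃ h : (BinTerm.node g (.node g' (.var (0 : Fin 3)) (.var 1)) (.var 2)).IsMultilinear,
      (magmatic k G).compL (magmaticGen k g) (magmaticGen k g') = magmaticTerm k ⟨_, h⟩ := by
  have h : (magmatic k G).compL (magmaticGen k g) (magmaticGen k g') =
      magmaticTerm k (MTerm.map unitSumFinTwoLeft (MTerm.insert
        (MTerm.map finTwoOption ⟨_, isMultilinear_mul g⟩) ⟨_, isMultilinear_mul g'⟩)) := by
    simp only [SymOperad.compL_apply, magmaticGen, ← magmaticTerm_eq_mono]
    rw [magmatic_map_term, magmatic_comp_term, magmatic_map_term]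
  exact ⟨(MTerm.map unitSumFinTwoLeft (MTerm.insert
        (MTerm.map finTwoOption ⟨_, isMultilinear_mul g⟩) ⟨_, isMultilinear_mul g'⟩)).2, h⟩

theorem magmatic_compR_gen {G : Type w} (g g' : G) :
    ∃ h : (BinTerm.node g (.var (0 : Fin 3)) (.node g' (.var 1) (.var 2))).IsMultilinear,
      (magmatic k G).compR (magmaticGen k g) (magmaticGen k g') = magmaticTerm k ⟨_, h⟩ := by
  have h : (magmatic k G).compR (magmaticGen k g) (magmaticGen k g') =
      magmaticTerm k (MTerm.map unitSumFinTwoRight (MTerm.insert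
        (MTerm.map finTwoOption (MTerm.map (Equiv.swap 0 1) ⟨_, isMultilinear_mul g⟩))
          ⟨_, isMultilinear_mul g'⟩)) := by
    simp only [SymOperad.compR_apply, SymOperad.flip, magmaticGen, ← magmaticTerm_eq_mono]
    rw [magmatic_map_term, magmatic_map_term, magmatic_comp_term, magmatic_map_term]
  exact ⟨(MTerm.map unitSumFinTwoRight (MTerm.insert
        (MTerm.map finTwoOption (MTerm.map (Equiv.swap 0 1) ⟨_, isMultilinear_mul g⟩))
          ⟨_, isMultilinear_mul g'⟩)).2, h⟩

/-- A tree with three leaves has one of two shapes, so equivariant statements in arity three need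
only be checked on `compL` and `compR` of generators. -/
theorem magmaticTerm_three {G : Type w} (t : MTerm G (Fin 3)) :
    ∃ (σ : Equiv.Perm (Fin 3)) (g g' : G),
      magmaticTerm k t = (magmatic k G).map σ
        ((magmatic k G).compL (magmaticGen k g) (magmaticGen k g')) ∨
      magmaticTerm k t = (magmatic k G).map σ
        ((magmatic k G).compR (magmaticGen k g) (magmaticGen k g')) := by
  obtain ⟨t, ht⟩ := t
  obtain ⟨g, g', x, rfl | rfl⟩ :=
    t.exists_eq_of_card_leaf_eq_three (ht.card_leaf.trans (by simp))
  · obtain ⟨h, h'⟩ := magmatic_compL_gen (k := k) g g'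
    have hx : Function.Bijective x := by
      refine (Finite.surjective_iff_bijective).1 fun y => ?_
      obtain ⟨((i | i) | i), hi⟩ := ht.2 y
      exacts [⟨0, hi⟩, ⟨1, hi⟩, ⟨2, hi⟩]
    refine ⟨Equiv.ofBijective x hx, g, g', .inl ?_⟩
    rw [h', magmatic_map_term]
    rfl
  · obtain ⟨h, h'⟩ := magmatic_compR_gen (k := k) g g'
    have hx : Function.Bijective x := by
      refine (Finite.surjective_iff_bijective).1 fun y => ?_
      obtain ⟨(i | (i | i)), hi⟩ := ht.2 y
      exacts [⟨0, hi⟩, ⟨1, hi⟩, ⟨2, hi⟩]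
    refine ⟨Equiv.ofBijective x hx, g, g', .inr ?_⟩
    rw [h', magmatic_map_term]
    rfl

/-! ### Ideals of the free operad generated in one arity -/

/-- The component at `A` of the ideal of all operations of arity `> n`, together with the
operations of arity `n` that become elements of `R` under every renaming of the inputs. -/
def truncCarrier {G : Type w} (n : ℕ) (R : Submodule k ((magmatic k G).obj (Fin n)))
    (A : Type) [Finite A] : Submodule k ((magmatic k G).obj A) where
  carrier := {p | (Nat.card A < n → p = 0) ∧ ∀ e : A ≃ Fin n, (magmatic k G).map e p ∈ R}
  zero_mem' := ⟨fun _ => rfl, fun e => by rw [map_zero]; exact R.zero_mem⟩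
  add_mem' := fun hp hq => ⟨fun h => by rw [hp.1 h, hq.1 h, add_zero],
    fun e => by rw [map_add]; exact R.add_mem (hp.2 e) (hq.2 e)⟩
  smul_mem' := fun c p hp => ⟨fun h => by rw [hp.1 h, smul_zero],
    fun e => by rw [map_smul]; exact R.smul_mem c (hp.2 e)⟩

/-- The ideal of all operations of arity `> n`, together with the operations of arity `n` that
become elements of `R` under every renaming of the inputs. -/
def truncIdeal {G : Type w} (n : ℕ) (R : Submodule k ((magmatic k G).obj (Fin n))) :
    (magmatic k G).Idl where
  carrier A _ := truncCarrier n R A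
  map_mem e p hp := by
    refine ⟨fun h => ?_, fun f => ?_⟩
    · rw [hp.1 (by rwa [Nat.card_congr e]), map_zero]
    · rw [SymOperad.map_map]
      exact hp.2 _
  comp_mem_left {A B} _ _ p q hp := by
    refine magmatic_mem (Submodule.comap ((magmatic k G).comp p) (truncCarrier n R _)) (fun s => ?_) q
    -- Every monomial has at least one leaf, so compositions never lower the arity.
    have hB : 0 < Nat.card B := s.2.card_leaf ▸ s.1.card_leaf_pos
    have hAB : Nat.card (A ⊕ B) = Nat.card A + Nat.card B := Nat.card_sum
    have hA : Nat.card (Option A) = Nat.card A + 1 := Finite.card_option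
    rw [Submodule.mem_comap]
    by_cases h : Nat.card (Option A) < n
    · rw [hp.1 h, map_zero, LinearMap.zero_apply]
      exact Submodule.zero_mem _
    -- A monomial of arity one is a renamed unit and its insertion is a renaming. Any larger
    -- monomial raises the arity above `n`, where the conditions are vacuous.
    by_cases h1 : Nat.card B = 1
    · obtain ⟨e, he⟩ := magmaticTerm_eq_map_one (k := k) s h1
      rw [he, SymOperad.comp_map_right, SymOperad.comp_one_eq, SymOperad.map_map]
      refine ⟨fun h' => absurd h' (by omega), fun f => ?_⟩
      rw [SymOperad.map_map]
      exact hp.2 _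
    · refine ⟨fun h' => absurd h' (by omega), fun f => ?_⟩
      have := Nat.card_congr f
      rw [Nat.card_fin] at this
      omega
  comp_mem_right {A B} _ _ p q hq := by
    refine magmatic_mem (Submodule.comap ((magmatic k G).comp.flip q)
      (truncCarrier n R _)) (fun s => ?_) p
    have hAB : Nat.card (A ⊕ B) = Nat.card A + Nat.card B := Nat.card_sum
    have hA : Nat.card (Option A) = Nat.card A + 1 := Finite.card_option
    rw [Submodule.mem_comap, LinearMap.flip_apply]
    by_cases h : Nat.card B < n
    · rw [hq.1 h, map_zero]
      exact Submodule.zero_mem _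
    -- Here the outer monomial has arity one and is a renamed unit; otherwise the composite again
    -- has arity above `n`.
    by_cases h1 : Nat.card A = 0
    · obtain ⟨e, he⟩ := magmaticTerm_eq_map_one (k := k) s (by omega)
      have : IsEmpty A := (Finite.card_eq_zero_iff).1 h1
      have h2 : (magmatic k G).map e (magmatic k G).one = (magmatic k G).map
          (Equiv.equivOfIsEmpty Empty A).optionCongr
          ((magmatic k G).map unitOption (magmatic k G).one) := by
        rw [SymOperad.map_map]
        apply SymOperad.map_congr
        intro i
        rcases e i with _ | a
        · rfl
        · exact isEmptyElim a
      rw [he, h2, SymOperad.comp_map_left, SymOperad.eq_map_symm _ (SymOperad.one_comp _ q),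
        SymOperad.map_map]
      refine ⟨fun h' => absurd h' (by omega), fun f => ?_⟩
      rw [SymOperad.map_map]
      exact hq.2 _
    · refine ⟨fun h' => absurd h' (by omega), fun f => ?_⟩
      have := Nat.card_congr f
      rw [Nat.card_fin] at this
      omega

theorem mem_truncIdeal {G : Type w} {n : ℕ} {R : Submodule k ((magmatic k G).obj (Fin n))}
    {A : Type} [Finite A] {p : (magmatic k G).obj A} :
    p ∈ (truncIdeal n R).carrier A ↔ (Nat.card A < n → p = 0) ∧
      ∀ e : A ≃ Fin n, (magmatic k G).map e p ∈ R := Iff.rfl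

/-- Compositions with non-units raise the arity, so in arity `n` relations of arity `n` generate
nothing beyond their renamings and linear combinations. Formally, `truncIdeal n R` is an ideal
containing `S`, and its component at `Fin n` lies in `R`. -/
theorem idealSpan_carrier_le {G : Type w} {n : ℕ}
    {R : Submodule k ((magmatic k G).obj (Fin n))}
    (hR : ∀ (σ : Equiv.Perm (Fin n)), ∀ p ∈ R, (magmatic k G).map σ p ∈ R)
    {S : Set (Σ n : ℕ, (magmatic k G).obj (Fin n))} (hS : ∀ x ∈ S, ∃ r ∈ R, x = ⟨n, r⟩) :
    ((magmatic k G).idealSpan S).carrier (Fin n) ≤ R := by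
  intro p hp
  have h := SymOperad.idealSpan_le (I := truncIdeal n R) (S := S) (fun x hx => by
    obtain ⟨r, hr, rfl⟩ := hS x hx
    exact mem_truncIdeal.2 ⟨fun h => absurd h (by simp), fun e => hR e r hr⟩) (Fin n) hp
  have h' := h.2 (Equiv.refl _)
  rwa [SymOperad.map_refl] at h'

/-- The comparison ideal is `truncIdeal n ⊤`, which vanishes below arity `n` and imposes nothing
from arity `n` on. -/
theorem idealSpan_carrier_eq_bot {G : Type w} {n : ℕ}
    {S : Set (Σ n : ℕ, (magmatic k G).obj (Fin n))} (hS : ∀ x ∈ S, x.1 = n) {A : Type}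
    [Finite A] (h : Nat.card A < n) : ((magmatic k G).idealSpan S).carrier A = ⊥ := by
  rw [eq_bot_iff]
  intro p hp
  have h' := SymOperad.idealSpan_le (I := truncIdeal n ⊤) (S := S) (fun x hx => by
    obtain ⟨m, r⟩ := x
    obtain rfl : m = n := hS _ hx
    exact mem_truncIdeal.2 ⟨fun h => absurd h (by simp), fun e => trivial⟩) A hp
  exact h'.1 h

/-! ### Multilinear elements of degree three with one operation -/

/-- The monomials `(x_{σ(1)} x_{σ(2)}) x_{σ(3)}` and `x_{σ(1)} (x_{σ(2)} x_{σ(3)})`. -/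
def bracketing : Bool × Equiv.Perm (Fin 3) → MTerm Unit (Fin 3)
  | (true, σ) => MTerm.map σ ⟨_, isMultilinear_left⟩
  | (false, σ) => MTerm.map σ ⟨_, isMultilinear_right⟩

/-- The operation `(x_{σ(1)} x_{σ(2)}) x_{σ(3)}`. -/
def magL (k : Type u) [Field k] (σ : Equiv.Perm (Fin 3)) : (magmatic k Unit).obj (Fin 3) :=
  magmaticTerm k (bracketing (true, σ))

/-- The operation `x_{σ(1)} (x_{σ(2)} x_{σ(3)})`. -/
def magR (k : Type u) [Field k] (σ : Equiv.Perm (Fin 3)) : (magmatic k Unit).obj (Fin 3) :=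
  magmaticTerm k (bracketing (false, σ))

theorem map_magL (σ τ : Equiv.Perm (Fin 3)) :
    (magmatic k Unit).map τ (magL k σ) = magL k (τ * σ) :=
  (magmatic_map_term _ _).trans (congrArg _ (MTerm.map_trans σ τ _).symm)

theorem map_magR (σ τ : Equiv.Perm (Fin 3)) :
    (magmatic k Unit).map τ (magR k σ) = magR k (τ * σ) :=
  (magmatic_map_term _ _).trans (congrArg _ (MTerm.map_trans σ τ _).symm)

theorem compL_gen_eq_magL :
    (magmatic k Unit).compL (magmaticGen k ()) (magmaticGen k ()) = magL k 1 := by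
  obtain ⟨h, h'⟩ := magmatic_compL_gen (k := k) () ()
  exact h'.trans (congrArg _ (MTerm.map_refl _).symm)

theorem compR_gen_eq_magR :
    (magmatic k Unit).compR (magmaticGen k ()) (magmaticGen k ()) = magR k 1 := by
  obtain ⟨h, h'⟩ := magmatic_compR_gen (k := k) () ()
  exact h'.trans (congrArg _ (MTerm.map_refl _).symm)

theorem associatorPerm_eq (σ : Equiv.Perm (Fin 3)) :
    associatorPerm k σ = magL k σ - magR k σ :=
  (map_sub _ _ _).trans (congrArg₂ _ (magmatic_map_term _ _) (magmatic_map_term _ _))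

theorem associator_eq : associator k = magL k 1 - magR k 1 := by
  rw [← associatorPerm_eq, associatorPerm]
  exact ((magmatic k Unit).map_refl _).symm

theorem bracketing_bijective : Function.Bijective bracketing := by
  constructor
  · rintro ⟨_ | _, σ⟩ ⟨_ | _, τ⟩ h <;> have h := congrArg Subtype.val h <;>
      simp only [bracketing, MTerm.map, BinTerm.rename, BinTerm.bind, BinTerm.node.injEq,
        BinTerm.var.injEq, reduceCtorEq, and_false, true_and] at h
    · refine Prod.ext rfl (Equiv.ext fun i => ?_)
      fin_cases i
      exacts [h.1, h.2.1, h.2.2]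
    · refine Prod.ext rfl (Equiv.ext fun i => ?_)
      fin_cases i
      exacts [h.1.1, h.1.2, h.2]
  · intro t
    -- The classification of monomials is stated for basis vectors. Since distinct monomials give
    -- distinct basis vectors, it can be read off over any field; `ℚ` is an arbitrary choice.
    have hinj : Function.Injective (magmaticTerm ℚ (G := Unit) (A := Fin 3)) :=
      Finsupp.single_left_injective one_ne_zero
    obtain ⟨σ, ⟨⟩, ⟨⟩, h | h⟩ := magmaticTerm_three (k := ℚ) t
    · refine ⟨(true, σ), hinj ?_⟩
      rw [h, compL_gen_eq_magL, map_magL, mul_one]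
      rfl
    · refine ⟨(false, σ), hinj ?_⟩
      rw [h, compR_gen_eq_magR, map_magR, mul_one]
      rfl

/-- The linear map with given values on the monomials of degree three. -/
def magThreeLift {M : Type*} [AddCommGroup M] [Module k M] (f g : Equiv.Perm (Fin 3) → M) :
    (magmatic k Unit).obj (Fin 3) →ₗ[k] M :=
  Finsupp.lift M k _ fun t =>
    (fun x : Bool × Equiv.Perm (Fin 3) => if x.1 then f x.2 else g x.2)
      ((Equiv.ofBijective _ bracketing_bijective).symm t)

section
variable {M : Type*} [AddCommGroup M] [Module k M]

theorem magThreeLift_bracketing (f g : Equiv.Perm (Fin 3) → M) (x : Bool × Equiv.Perm (Fin 3)) :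
    magThreeLift f g (magmaticTerm k (bracketing x)) = if x.1 then f x.2 else g x.2 := by
  simp only [magThreeLift]
  refine (Finsupp.sum_single_index ?_).trans ?_
  · exact zero_smul k _
  · refine (one_smul k _).trans ?_
    exact congrArg (fun x : Bool × Equiv.Perm (Fin 3) => if x.1 then f x.2 else g x.2)
      (Equiv.ofBijective_symm_apply_apply _ bracketing_bijective x)

theorem magThreeLift_magL (f g : Equiv.Perm (Fin 3) → M) (σ : Equiv.Perm (Fin 3)) :
    magThreeLift f g (magL k σ) = f σ :=
  magThreeLift_bracketing f g (true, σ)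

theorem magThreeLift_magR (f g : Equiv.Perm (Fin 3) → M) (σ : Equiv.Perm (Fin 3)) :
    magThreeLift f g (magR k σ) = g σ :=
  magThreeLift_bracketing f g (false, σ)

theorem magThree_ext {f g : (magmatic k Unit).obj (Fin 3) →ₗ[k] M}
    (hL : ∀ σ, f (magL k σ) = g (magL k σ)) (hR : ∀ σ, f (magR k σ) = g (magR k σ)) : f = g := by
  refine magmatic_linearMap_ext fun t => ?_
  obtain ⟨⟨_ | _, σ⟩, rfl⟩ := bracketing_bijective.2 t
  · exact hR σ
  · exact hL σ

/-- If a linear map `T` on the multilinear elements of degree three kills the defining identities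
of a variety and is equivariant for some linear maps `a σ`, then it kills all identities of the
variety in degree three. -/
theorem idealSpan_carrier_le_ker (T : (magmatic k Unit).obj (Fin 3) →ₗ[k] M)
    (a : Equiv.Perm (Fin 3) → M →ₗ[k] M) (hL : ∀ τ σ, T (magL k (τ * σ)) = a τ (T (magL k σ)))
    (hR : ∀ τ σ, T (magR k (τ * σ)) = a τ (T (magR k σ)))
    {S : Set (Σ n : ℕ, (magmatic k Unit).obj (Fin n))}
    (hS : ∀ x ∈ S, ∃ r, T r = 0 ∧ x = ⟨3, r⟩) :
    ((magmatic k Unit).idealSpan S).carrier (Fin 3) ≤ LinearMap.ker T := by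
  refine idealSpan_carrier_le (fun σ p hp => ?_) hS
  have h : T ∘ₗ (magmatic k Unit).map σ = a σ ∘ₗ T :=
    magThree_ext (fun τ => by simp only [LinearMap.comp_apply, map_magL, hL])
      (fun τ => by simp only [LinearMap.comp_apply, map_magR, hR])
  have h' := LinearMap.congr_fun h p
  rw [LinearMap.comp_apply, LinearMap.comp_apply, LinearMap.mem_ker.1 hp, map_zero] at h'
  exact h'

end

/-! ### Varieties -/

section

variable (S : Set (Σ n : ℕ, (magmatic k Unit).obj (Fin n)))

/-- The operation `(x_{σ(1)} x_{σ(2)}) x_{σ(3)}` of a variety. -/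
def variety.opL (σ : Equiv.Perm (Fin 3)) : (variety k S).obj (Fin 3) :=
  (magmatic k Unit).quotMk S (magL k σ)

/-- The operation `x_{σ(1)} (x_{σ(2)} x_{σ(3)})` of a variety. -/
def variety.opR (σ : Equiv.Perm (Fin 3)) : (variety k S).obj (Fin 3) :=
  (magmatic k Unit).quotMk S (magR k σ)

/-- The associator of a variety with permuted variables. -/
def variety.opA (σ : Equiv.Perm (Fin 3)) : (variety k S).obj (Fin 3) :=
  variety.opL S σ - variety.opR S σ

theorem variety.map_opL (σ τ : Equiv.Perm (Fin 3)) :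
    (variety k S).map τ (variety.opL S σ) = variety.opL S (τ * σ) :=
  congrArg ((magmatic k Unit).quotMk S) (map_magL σ τ)

theorem variety.map_opR (σ τ : Equiv.Perm (Fin 3)) :
    (variety k S).map τ (variety.opR S σ) = variety.opR S (τ * σ) :=
  congrArg ((magmatic k Unit).quotMk S) (map_magR σ τ)

theorem variety.map_opA (σ τ : Equiv.Perm (Fin 3)) :
    (variety k S).map τ (variety.opA S σ) = variety.opA S (τ * σ) := by
  rw [variety.opA, map_sub, variety.map_opL, variety.map_opR, variety.opA]

theorem variety.quotMk_associatorPerm (σ : Equiv.Perm (Fin 3)) :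
    (magmatic k Unit).quotMk S (associatorPerm k σ) = variety.opA S σ := by
  rw [associatorPerm_eq, map_sub]
  rfl

theorem variety.quotMk_associator :
    (magmatic k Unit).quotMk S (associator k) = variety.opA S 1 := by
  rw [associator_eq, map_sub]
  rfl

/-- Applying `σ` to the defining identity multiplies on the left, so the transformation `τ` of the
identity appears on the right. -/
theorem variety.opA_add_opA {τ : Equiv.Perm (Fin 3)}
    (h : (⟨3, associator k + associatorPerm k τ⟩ : Σ n : ℕ, (magmatic k Unit).obj (Fin n)) ∈ S)
    (σ : Equiv.Perm (Fin 3)) : variety.opA S (σ * τ) = -variety.opA S σ := by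
  have h1 := SymOperad.quotMk_eq_zero h
  rw [map_add, variety.quotMk_associator, variety.quotMk_associatorPerm] at h1
  have h2 := congrArg ((variety k S).map σ) h1
  rw [map_add, variety.map_opA, variety.map_opA, map_zero, mul_one] at h2
  exact eq_neg_of_add_eq_zero_right h2

section
variable {M : Type*} [AddCommGroup M] [Module k M]

/-- The linear map on the operations of arity three of a variety which is induced by a linear map
that kills the identities of degree three. -/
def variety.threeLift (T : (magmatic k Unit).obj (Fin 3) →ₗ[k] M)
    (hT : ((magmatic k Unit).idealSpan S).carrier (Fin 3) ≤ LinearMap.ker T) :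
    (variety k S).obj (Fin 3) →ₗ[k] M :=
  Submodule.liftQ _ T hT

theorem variety.threeLift_opL (T : (magmatic k Unit).obj (Fin 3) →ₗ[k] M)
    (hT : ((magmatic k Unit).idealSpan S).carrier (Fin 3) ≤ LinearMap.ker T)
    (σ : Equiv.Perm (Fin 3)) :
    variety.threeLift S T hT (variety.opL S σ) = T (magL k σ) :=
  rfl

theorem variety.threeLift_opR (T : (magmatic k Unit).obj (Fin 3) →ₗ[k] M)
    (hT : ((magmatic k Unit).idealSpan S).carrier (Fin 3) ≤ LinearMap.ker T)
    (σ : Equiv.Perm (Fin 3)) :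
    variety.threeLift S T hT (variety.opR S σ) = T (magR k σ) :=
  rfl

theorem variety.three_ext {S : Set (Σ n : ℕ, (magmatic k Unit).obj (Fin n))}
    {f g : (variety k S).obj (Fin 3) →ₗ[k] M}
    (hL : ∀ σ, f (variety.opL S σ) = g (variety.opL S σ))
    (hR : ∀ σ, f (variety.opR S σ) = g (variety.opR S σ)) : f = g := by
  have h : f ∘ₗ (magmatic k Unit).quotMk S = g ∘ₗ (magmatic k Unit).quotMk S :=
    magThree_ext hL hR
  refine LinearMap.ext fun p => ?_
  obtain ⟨p, rfl⟩ := (magmatic k Unit).quotMk_surjective S p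
  exact LinearMap.congr_fun h p

theorem variety.two_ext {S : Set (Σ n : ℕ, (magmatic k Unit).obj (Fin n))}
    {f g : (variety k S).obj (Fin 2) →ₗ[k] M} (h : f (variety.mul k S) = g (variety.mul k S))
    (h' : f ((variety k S).flip (variety.mul k S)) = g ((variety k S).flip (variety.mul k S))) :
    f = g := by
  have h : f ∘ₗ (magmatic k Unit).quotMk S = g ∘ₗ (magmatic k Unit).quotMk S := by
    refine magmatic_linearMap_ext fun t => ?_
    obtain ⟨⟨⟩, ht | ht⟩ := magmaticTerm_two (k := k) t
    · rw [ht]; exact h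
    · rw [ht]; exact h'
  refine LinearMap.ext fun p => ?_
  obtain ⟨p, rfl⟩ := (magmatic k Unit).quotMk_surjective S p
  exact LinearMap.congr_fun h p

end

/-- The eight composites of the product and its opposite follow. In every value of `compL` the
letter outside the inner product is `x₃`, and in every value of `compR` it is `x₁`. -/
theorem variety.compL_mul_mul :
    (variety k S).compL (variety.mul k S) (variety.mul k S) = variety.opL S 1 :=
  (((magmatic k Unit).quotHom S).app_compL _ _).symm.trans
    (congrArg ((magmatic k Unit).quotMk S) compL_gen_eq_magL)

theorem variety.compR_mul_mul :
    (variety k S).compR (variety.mul k S) (variety.mul k S) = variety.opR S 1 :=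
  (((magmatic k Unit).quotHom S).app_compR _ _).symm.trans
    (congrArg ((magmatic k Unit).quotMk S) compR_gen_eq_magR)

theorem variety.compL_mul_flip :
    (variety k S).compL (variety.mul k S) ((variety k S).flip (variety.mul k S)) =
      variety.opL S (Equiv.swap 0 1) := by
  rw [SymOperad.compL_flip_right, variety.compL_mul_mul, variety.map_opL, mul_one]

theorem variety.compR_mul_flip :
    (variety k S).compR (variety.mul k S) ((variety k S).flip (variety.mul k S)) =
      variety.opR S (Equiv.swap 1 2) := by
  rw [SymOperad.compR_flip_right, variety.compR_mul_mul, variety.map_opR, mul_one]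

theorem variety.compL_flip_mul :
    (variety k S).compL ((variety k S).flip (variety.mul k S)) (variety.mul k S) =
      variety.opR S (finRotate 3).symm := by
  rw [SymOperad.compL_flip_left, variety.compR_mul_mul, variety.map_opR, mul_one]

theorem variety.compR_flip_mul :
    (variety k S).compR ((variety k S).flip (variety.mul k S)) (variety.mul k S) =
      variety.opL S (finRotate 3) := by
  rw [SymOperad.compR_flip_left, variety.compL_mul_mul, variety.map_opL, mul_one]

theorem variety.compL_flip_flip :
    (variety k S).compL ((variety k S).flip (variety.mul k S))
      ((variety k S).flip (variety.mul k S)) = variety.opR S (Equiv.swap 0 2) := by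
  rw [SymOperad.compL_flip_flip, variety.compR_mul_mul, variety.map_opR, mul_one]

theorem variety.compR_flip_flip :
    (variety k S).compR ((variety k S).flip (variety.mul k S))
      ((variety k S).flip (variety.mul k S)) = variety.opL S (Equiv.swap 0 2) := by
  rw [SymOperad.compR_flip_flip, variety.compL_mul_mul, variety.map_opL, mul_one]

end

attribute [irreducible] variety.opL variety.opR

/-! ### Degree three of associative, alternative and flexible algebras -/

/-- The sign of a permutation as a scalar. -/
def sgn (k : Type u) [Field k] (σ : Equiv.Perm (Fin 3)) : k :=
  ((Equiv.Perm.sign σ : ℤ) : k)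

theorem sgn_mul (σ τ : Equiv.Perm (Fin 3)) : sgn k (σ * τ) = sgn k σ * sgn k τ := by
  simp [sgn]

theorem sgn_one : sgn k 1 = 1 := by simp [sgn]

theorem sgn_swap {i j : Fin 3} (h : i ≠ j) : sgn k (Equiv.swap i j) = -1 := by
  simp [sgn, Equiv.Perm.sign_swap h]

/-- The isomorphism `As(3) ≅ k[S₃]`. -/
def asThree (k : Type u) [Field k] : (variety k (asRel k)).obj (Fin 3) →ₗ[k] Equiv.Perm (Fin 3) →₀ k :=
  variety.threeLift (asRel k)
    (magThreeLift (fun σ => Finsupp.single σ 1) (fun σ => Finsupp.single σ 1))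
    (idealSpan_carrier_le_ker _ (fun τ => Finsupp.lmapDomain k k (τ * ·))
      (fun τ σ => by simp [magThreeLift_magL])
      (fun τ σ => by simp [magThreeLift_magR])
      (by
        rintro x rfl
        exact ⟨_, by rw [associator_eq, map_sub, magThreeLift_magL, magThreeLift_magR, sub_self],
          rfl⟩))

theorem asThree_opL (σ : Equiv.Perm (Fin 3)) :
    asThree k (variety.opL (asRel k) σ) = Finsupp.single σ 1 :=
  (variety.threeLift_opL _ _ _ σ).trans (magThreeLift_magL _ _ σ)

theorem asThree_opR (σ : Equiv.Perm (Fin 3)) :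
    asThree k (variety.opR (asRel k) σ) = Finsupp.single σ 1 :=
  (variety.threeLift_opR _ _ _ σ).trans (magThreeLift_magR _ _ σ)

/-- Coordinates on `Alt(3)`. -/
def altThree (k : Type u) [Field k] :
    (variety k (altRel k)).obj (Fin 3) →ₗ[k] (Equiv.Perm (Fin 3) →₀ k) × k :=
  variety.threeLift (altRel k)
    (magThreeLift (fun σ => (Finsupp.single σ 1, sgn k σ)) (fun σ => (Finsupp.single σ 1, 0)))
    (idealSpan_carrier_le_ker _
      (fun τ => (Finsupp.lmapDomain k k (τ * ·)).prodMap (LinearMap.lsmul k k (sgn k τ)))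
      (fun τ σ => by simp [magThreeLift_magL, sgn_mul])
      (fun τ σ => by simp [magThreeLift_magR])
      (by
        -- The associator goes to `(0, 1)` and its transpose to `(0, -1)`.
        rintro x (rfl | rfl) <;> refine ⟨_, ?_, rfl⟩ <;>
          rw [associator_eq, associatorPerm_eq] <;>
          simp only [map_add, map_sub, magThreeLift_magL, magThreeLift_magR, sgn_one] <;>
          rw [sgn_swap (by decide)] <;> simp))

theorem altThree_opL (σ : Equiv.Perm (Fin 3)) :
    altThree k (variety.opL (altRel k) σ) = (Finsupp.single σ 1, sgn k σ) :=
  (variety.threeLift_opL _ _ _ σ).trans (magThreeLift_magL _ _ σ)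

theorem altThree_opR (σ : Equiv.Perm (Fin 3)) :
    altThree k (variety.opR (altRel k) σ) = (Finsupp.single σ 1, 0) :=
  (variety.threeLift_opR _ _ _ σ).trans (magThreeLift_magR _ _ σ)

/-- The two defining identities say that the adjacent transpositions negate the associator. They
generate `S₃`, and the six permutations are written out as words in them. -/
theorem alt_opA (σ : Equiv.Perm (Fin 3)) :
    variety.opA (altRel k) σ = sgn k σ • variety.opA (altRel k) 1 := by
  have hs := variety.opA_add_opA (altRel k) (τ := Equiv.swap 0 1) (.inl rfl)
  have ht := variety.opA_add_opA (altRel k) (τ := Equiv.swap 1 2) (.inr rfl)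
  have hs' : sgn k (Equiv.swap 0 1) = -1 := sgn_swap (by decide)
  have ht' : sgn k (Equiv.swap 1 2) = -1 := sgn_swap (by decide)
  obtain rfl | rfl | rfl | rfl | rfl | rfl : σ = 1 ∨ σ = 1 * Equiv.swap 0 1 ∨
      σ = 1 * Equiv.swap 1 2 ∨ σ = 1 * Equiv.swap 0 1 * Equiv.swap 1 2 ∨
      σ = 1 * Equiv.swap 1 2 * Equiv.swap 0 1 ∨
      σ = 1 * Equiv.swap 0 1 * Equiv.swap 1 2 * Equiv.swap 0 1 := by
    revert σ; decide
  all_goals simp only [hs, ht, sgn_mul, hs', ht', sgn_one]; simp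

/-- The isomorphism of `Alt(3)` with the coordinate space. -/
def altThreeEquiv (k : Type u) [Field k] :
    (variety k (altRel k)).obj (Fin 3) ≃ₗ[k] (Equiv.Perm (Fin 3) →₀ k) × k :=
  LinearEquiv.ofLinearMap (altThree k)
    ((Finsupp.linearCombination k (variety.opR (altRel k))).coprod
      (LinearMap.toSpanSingleton k _ (variety.opA (altRel k) 1)))
    (by
      refine LinearMap.prod_ext (Finsupp.lhom_ext' fun σ => LinearMap.ext_ring ?_)
        (LinearMap.ext_ring ?_)
      · simp [altThree_opR]
      · simp [variety.opA, altThree_opL, altThree_opR, sgn_one])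
    (variety.three_ext (fun σ => by
        rw [LinearMap.comp_apply, altThree_opL, LinearMap.coprod_apply,
          Finsupp.linearCombination_single, one_smul, LinearMap.toSpanSingleton_apply, ← alt_opA]
        exact add_sub_cancel _ _)
      (fun σ => by simp [altThree_opR]))

theorem finrank_alt_three : Module.finrank k ((Alt k).obj (Fin 3)) = 7 := by
  change Module.finrank k ((variety k (altRel k)).obj (Fin 3)) = 7
  rw [(altThreeEquiv k).finrank_eq, Module.finrank_prod, Module.finrank_finsupp_self,
    Fintype.card_perm, Module.finrank_self]
  rfl

/-- Coordinates on `Flex(3)`. -/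
def flexThree (k : Type u) [Field k] :
    (variety k (flexRel k)).obj (Fin 3) →ₗ[k] (Equiv.Perm (Fin 3) →₀ k) × (Fin 3 →₀ k) :=
  variety.threeLift (flexRel k)
    (magThreeLift (fun σ => (Finsupp.single σ 1, Finsupp.single (σ 1) (sgn k σ)))
      (fun σ => (Finsupp.single σ 1, 0)))
    (idealSpan_carrier_le_ker _
      (fun τ => (Finsupp.lmapDomain k k (τ * ·)).prodMap
        (sgn k τ • Finsupp.lmapDomain k k τ))
      (fun τ σ => by simp [magThreeLift_magL, sgn_mul])
      (fun τ σ => by simp [magThreeLift_magR])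
      (by
        rintro x rfl
        refine ⟨_, ?_, rfl⟩
        -- The exchange of the outer letters keeps the middle one, so both associators contribute to
        -- the same coordinate, with opposite signs.
        have h : (Equiv.swap 0 2 : Equiv.Perm (Fin 3)) 1 = 1 := by decide
        rw [associator_eq, associatorPerm_eq]
        simp only [map_add, map_sub, magThreeLift_magL, magThreeLift_magR, sgn_one, h]
        rw [sgn_swap (by decide)]
        simp))

theorem flexThree_opL (σ : Equiv.Perm (Fin 3)) :
    flexThree k (variety.opL (flexRel k) σ) =
      (Finsupp.single σ 1, Finsupp.single (σ 1) (sgn k σ)) :=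
  (variety.threeLift_opL _ _ _ σ).trans (magThreeLift_magL _ _ σ)

theorem flexThree_opR (σ : Equiv.Perm (Fin 3)) :
    flexThree k (variety.opR (flexRel k) σ) = (Finsupp.single σ 1, 0) :=
  (variety.threeLift_opR _ _ _ σ).trans (magThreeLift_magR _ _ σ)

theorem flex_opA_mul_swap (σ : Equiv.Perm (Fin 3)) :
    variety.opA (flexRel k) (σ * Equiv.swap 0 2) = -variety.opA (flexRel k) σ :=
  variety.opA_add_opA (flexRel k) rfl σ

/-- Translation by `σ 1 - 1` is the even permutation with the same middle letter as `σ`. The only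
other permutation with this middle letter is its product with `swap 0 2`, where the flexible
identity supplies the sign. -/
theorem flex_opA (σ : Equiv.Perm (Fin 3)) :
    sgn k σ • variety.opA (flexRel k) (Equiv.addRight (σ 1 - 1)) =
      variety.opA (flexRel k) σ := by
  have h : (σ = Equiv.addRight (σ 1 - 1) ∧ Equiv.Perm.sign σ = 1) ∨
      (σ = Equiv.addRight (σ 1 - 1) * Equiv.swap 0 2 ∧ Equiv.Perm.sign σ = -1) := by
    revert σ; decide
  rcases h with ⟨h, h'⟩ | ⟨h, h'⟩
  · rw [← h, sgn, h']
    simp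
  · conv_rhs => rw [h, flex_opA_mul_swap]
    rw [sgn, h']
    simp

/-- The isomorphism of `Flex(3)` with the coordinate space. -/
def flexThreeEquiv (k : Type u) [Field k] :
    (variety k (flexRel k)).obj (Fin 3) ≃ₗ[k] (Equiv.Perm (Fin 3) →₀ k) × (Fin 3 →₀ k) :=
  LinearEquiv.ofLinearMap (flexThree k)
    ((Finsupp.linearCombination k (variety.opR (flexRel k))).coprod
      (Finsupp.linearCombination k
        (fun i => variety.opA (flexRel k) (Equiv.addRight (i - 1)))))
    (by
      refine LinearMap.prod_ext (Finsupp.lhom_ext' fun σ => LinearMap.ext_ring ?_)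
        (Finsupp.lhom_ext' fun i => LinearMap.ext_ring ?_)
      · simp [flexThree_opR]
      · have h : Equiv.Perm.sign (Equiv.addRight (i - 1)) = 1 := by revert i; decide
        simp [variety.opA, flexThree_opL, flexThree_opR, sgn, h])
    (variety.three_ext (fun σ => by
        rw [LinearMap.comp_apply, flexThree_opL, LinearMap.coprod_apply,
          Finsupp.linearCombination_single, one_smul, Finsupp.linearCombination_single, flex_opA]
        exact add_sub_cancel _ _)
      (fun σ => by simp [flexThree_opR]))

theorem finrank_flex_three : Module.finrank k ((Flex k).obj (Fin 3)) = 9 := by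
  change Module.finrank k ((variety k (flexRel k)).obj (Fin 3)) = 9
  rw [(flexThreeEquiv k).finrank_eq, Module.finrank_prod, Module.finrank_finsupp_self,
    Module.finrank_finsupp_self, Fintype.card_perm]
  rfl

/-! ### The morphism from the symmetrization to flexible algebras -/

/-- The operad of commutative associative algebras. -/
def Com (k : Type u) [Field k] : SymOperad.{u, u} k where
  obj _ _ := k
  map _ := LinearMap.id
  one := 1
  comp := LinearMap.mul k k
  map_refl _ := rfl
  map_trans _ _ _ := rfl
  comp_map _ _ _ _ := rfl
  comp_assoc p q r := mul_assoc p q r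
  comp_comm p q r := mul_right_comm p q r
  comp_one p := mul_one p
  one_comp q := one_mul q

/-- The morphism from associative to commutative associative algebras. -/
def asToCom (k : Type u) [Field k] : (variety k (asRel k)).Hom (Com k) :=
  ((Com k).liftHom (fun _ => (1 : k))).descend (asRel k) (by
    rintro x rfl
    have h := (Com k).liftHom_magmaticGen (fun _ : Unit => (1 : k)) ()
    change ((Com k).liftHom (fun _ : Unit => (1 : k))).app (Fin 3) (associator k) = 0
    rw [associator_eq, ← compL_gen_eq_magL, ← compR_gen_eq_magR, map_sub,
      SymOperad.Hom.app_compL, SymOperad.Hom.app_compR, h]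
    exact sub_self (1 * 1 : k))

theorem asToCom_mul : (asToCom k).app _ (variety.mul k (asRel k)) = (1 : k) :=
  (Com k).liftHom_magmaticGen _ ()

theorem asToCom_flip (a : (variety k (asRel k)).obj (Fin 2)) :
    (asToCom k).app _ ((variety k (asRel k)).flip a) = (asToCom k).app _ a :=
  (asToCom k).app_flip a

/-- The identification of binary alternative and binary flexible operations. -/
def altToFlexTwo (k : Type u) [Field k] :
    (variety k (altRel k)).obj (Fin 2) →ₗ[k] (variety k (flexRel k)).obj (Fin 2) :=
  Submodule.liftQ _ ((magmatic k Unit).quotMk (flexRel k) (A := Fin 2)) (by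
    -- The alternative identities start in degree three, so they impose nothing on binary
    -- operations.
    rw [idealSpan_carrier_eq_bot (n := 3) (S := altRel k) (A := Fin 2)
      (by rintro x (rfl | rfl) <;> rfl) (by simp)]
    exact bot_le)

theorem altToFlexTwo_mul :
    altToFlexTwo k (variety.mul k (altRel k)) = variety.mul k (flexRel k) :=
  rfl

theorem altToFlexTwo_flip (a : (variety k (altRel k)).obj (Fin 2)) :
    altToFlexTwo k ((variety k (altRel k)).flip a) =
      (variety k (flexRel k)).flip (altToFlexTwo k a) := by
  obtain ⟨a, rfl⟩ := (magmatic k Unit).quotMk_surjective _ a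
  rfl

/-- The Hadamard product `As ⊗ Alt`. -/
abbrev AsAlt (k : Type u) [Field k] : SymOperad.{u, u} k :=
  (variety k (asRel k)).hadamard (variety k (altRel k))

/-- The tensor product of an associative and an alternative operation. -/
abbrev asAltTmul {A : Type} [Finite A] : (variety k (asRel k)).obj A →ₗ[k]
    (variety k (altRel k)).obj A →ₗ[k] (AsAlt k).obj A :=
  (variety k (asRel k)).tmul (variety k (altRel k))

/-- The binary flexible operation which is the image of an element of `As(2) ⊗ Alt(2)`. -/
def genToFlex (k : Type u) [Field k] :
    (AsAlt k).obj (Fin 2) →ₗ[k] (variety k (flexRel k)).obj (Fin 2) :=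
  TensorProduct.lift ((LinearMap.lsmul k _).compl₁₂ ((asToCom k).app (Fin 2)) (altToFlexTwo k))

theorem genToFlex_tmul (a : (variety k (asRel k)).obj (Fin 2))
    (b : (variety k (altRel k)).obj (Fin 2)) :
    genToFlex k (asAltTmul a b) = (show k from (asToCom k).app _ a) • altToFlexTwo k b :=
  rfl

theorem genToFlex_flip (g : (AsAlt k).obj (Fin 2)) :
    genToFlex k ((AsAlt k).flip g) = (variety k (flexRel k)).flip (genToFlex k g) := by
  revert g
  refine LinearMap.congr_fun (f := genToFlex k ∘ₗ (AsAlt k).flip)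
    (g := (variety k (flexRel k)).flip ∘ₗ genToFlex k) (SymOperad.tmul_ext fun a b => ?_)
  rw [LinearMap.comp_apply, LinearMap.comp_apply, SymOperad.flip_tmul, genToFlex_tmul,
    genToFlex_tmul, asToCom_flip, altToFlexTwo_flip, map_smul]

/-! ### Recovering flexible operations of arity three from `As(3) ⊗ Alt(3)` -/

section
open variety

/-- The linear section `Alt(3) → Flex(3)` of the projection which fixes the monomials in which
`x₂` is a factor of the inner product. -/
def altToFlexThree (k : Type u) [Field k] :
    (variety k (altRel k)).obj (Fin 3) →ₗ[k] (variety k (flexRel k)).obj (Fin 3) :=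
  ((Finsupp.linearCombination k (fun σ : Equiv.Perm (Fin 3) =>
      -- When `σ 0 = 1`, the letter `x₂` stands outside the inner product of `opR σ`. In `Alt` this
      -- monomial equals `opL σ` minus a signed copy of the associator `(x₁,x₂,x₃)`, an expression
      -- in admissible monomials that is then read in `Flex`.
      if σ 0 = 1 then opL (flexRel k) σ - sgn k σ • opA (flexRel k) 1
      else opR (flexRel k) σ)).coprod
    (LinearMap.toSpanSingleton k _ (opA (flexRel k) 1))) ∘ₗ altThree k

theorem altToFlexThree_opR {σ : Equiv.Perm (Fin 3)} (h : σ 0 ≠ 1) :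
    altToFlexThree k (opR (altRel k) σ) = opR (flexRel k) σ := by
  rw [altToFlexThree, LinearMap.comp_apply, altThree_opR, LinearMap.coprod_apply,
    Finsupp.linearCombination_single, one_smul, if_neg h]
  exact (congrArg _ (map_zero _)).trans (add_zero _)

theorem altToFlexThree_opL {σ : Equiv.Perm (Fin 3)} (h : σ 2 ≠ 1) :
    altToFlexThree k (opL (altRel k) σ) = opL (flexRel k) σ := by
  rw [altToFlexThree, LinearMap.comp_apply, altThree_opL, LinearMap.coprod_apply,
    Finsupp.linearCombination_single, one_smul, LinearMap.toSpanSingleton_apply]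
  split_ifs with h0
  · exact sub_add_cancel _ _
  -- Now `x₂` is the middle letter, so `σ` is the identity or the exchange of the outer letters.
  -- This is the only place in the construction of the section where flexibility is needed.
  · have hA : opA (flexRel k) σ = sgn k σ • opA (flexRel k) 1 := by
      obtain rfl | rfl : σ = 1 ∨ σ = 1 * Equiv.swap 0 2 := by revert σ; decide
      · rw [sgn_one, one_smul]
      · rw [flex_opA_mul_swap, sgn_mul, sgn_one, sgn_swap (by decide), one_mul, neg_one_smul]
    rw [← hA]
    exact add_sub_cancel _ _

/-- A linear map that recovers the value of an arity three operation of `As ∘ Alt` in `Flex` from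
its value in `As ⊗ Alt`. -/
def hadamardToFlexThree (k : Type u) [Field k] :
    (AsAlt k).obj (Fin 3) →ₗ[k] (variety k (flexRel k)).obj (Fin 3) :=
  TensorProduct.lift ((Finsupp.linearCombination k (fun σ : Equiv.Perm (Fin 3) =>
    (variety k (flexRel k)).map σ ∘ₗ altToFlexThree k ∘ₗ (variety k (altRel k)).map σ.symm)) ∘ₗ
      asThree k)

theorem hadamardToFlexThree_opL (σ : Equiv.Perm (Fin 3))
    (b : (variety k (altRel k)).obj (Fin 3)) :
    hadamardToFlexThree k (asAltTmul (opL (asRel k) σ) b) =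
      (variety k (flexRel k)).map σ (altToFlexThree k ((variety k (altRel k)).map σ.symm b)) := by
  refine (TensorProduct.lift.tmul _ _).trans ?_
  rw [LinearMap.comp_apply, asThree_opL, Finsupp.linearCombination_single, one_smul]
  rfl

theorem hadamardToFlexThree_opR (σ : Equiv.Perm (Fin 3))
    (b : (variety k (altRel k)).obj (Fin 3)) :
    hadamardToFlexThree k (asAltTmul (opR (asRel k) σ) b) =
      (variety k (flexRel k)).map σ (altToFlexThree k ((variety k (altRel k)).map σ.symm b)) := by
  refine (TensorProduct.lift.tmul _ _).trans ?_
  rw [LinearMap.comp_apply, asThree_opR, Finsupp.linearCombination_single, one_smul]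
  rfl

/-- Conjugation by `σ` replaces `x₂` by the middle letter of the word `σ`; the hypothesis says that
this letter is in the inner product of the monomial `τ`. -/
theorem map_altToFlexThree_opL {σ τ : Equiv.Perm (Fin 3)} (h : τ 2 ≠ σ 1) :
    (variety k (flexRel k)).map σ (altToFlexThree k ((variety k (altRel k)).map σ.symm
      (opL (altRel k) τ))) = opL (flexRel k) τ := by
  rw [map_opL, altToFlexThree_opL, map_opL]
  · congr 1
    exact mul_inv_cancel_left σ τ
  · simpa [Equiv.symm_apply_eq] using h

theorem map_altToFlexThree_opR {σ τ : Equiv.Perm (Fin 3)} (h : τ 0 ≠ σ 1) :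
    (variety k (flexRel k)).map σ (altToFlexThree k ((variety k (altRel k)).map σ.symm
      (opR (altRel k) τ))) = opR (flexRel k) τ := by
  rw [map_opR, altToFlexThree_opR, map_opR]
  · congr 1
    exact mul_inv_cancel_left σ τ
  · simpa [Equiv.symm_apply_eq] using h

/-- Renaming by `τ` changes the word `σ` into `τ * σ`, and the inner renaming by `(τ * σ).symm`
cancels that of the alternative factor. -/
theorem hadamardToFlexThree_map (τ : Equiv.Perm (Fin 3))
    (x : (AsAlt k).obj (Fin 3)) :
    hadamardToFlexThree k ((AsAlt k).map τ x) =
      (variety k (flexRel k)).map τ (hadamardToFlexThree k x) := by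
  have h1 : ∀ (σ : Equiv.Perm (Fin 3)) (b : (variety k (altRel k)).obj (Fin 3)),
      (variety k (altRel k)).map (τ * σ).symm ((variety k (altRel k)).map τ b) =
        (variety k (altRel k)).map σ.symm b := by
    intro σ b
    rw [SymOperad.map_map]
    apply SymOperad.map_congr
    intro i
    simp [Equiv.Perm.mul_def]
  revert x
  refine LinearMap.congr_fun
    (f := hadamardToFlexThree k ∘ₗ (AsAlt k).map τ)
    (g := (variety k (flexRel k)).map τ ∘ₗ hadamardToFlexThree k)
    (SymOperad.tmul_ext fun a b => ?_)
  rw [LinearMap.comp_apply, LinearMap.comp_apply, SymOperad.map_tmul]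
  revert a
  refine LinearMap.congr_fun
    (f := hadamardToFlexThree k ∘ₗ asAltTmul.flip ((variety k (altRel k)).map τ b) ∘ₗ
      (variety k (asRel k)).map τ)
    (g := (variety k (flexRel k)).map τ ∘ₗ hadamardToFlexThree k ∘ₗ asAltTmul.flip b)
    (three_ext (fun σ => ?_) (fun σ => ?_))
  · simp only [LinearMap.comp_apply, LinearMap.flip_apply]
    rw [map_opL, hadamardToFlexThree_opL, hadamardToFlexThree_opL, h1, SymOperad.map_map]
    rfl
  · simp only [LinearMap.comp_apply, LinearMap.flip_apply]
    rw [map_opR, hadamardToFlexThree_opR, hadamardToFlexThree_opR, h1, SymOperad.map_map]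
    rfl

theorem asAltTwo_ext {M : Type*} [AddCommGroup M] [Module k M] {f g : (AsAlt k).obj (Fin 2) →ₗ[k] M}
    (h : ∀ a b, (a = mul k (asRel k) ∨ a = (variety k (asRel k)).flip (mul k (asRel k))) →
      (b = mul k (altRel k) ∨ b = (variety k (altRel k)).flip (mul k (altRel k))) →
      f (asAltTmul a b) = g (asAltTmul a b)) : f = g := by
  refine TensorProduct.ext (two_ext (two_ext ?_ ?_) (two_ext ?_ ?_))
  exacts [h _ _ (.inl rfl) (.inl rfl), h _ _ (.inl rfl) (.inr rfl), h _ _ (.inr rfl) (.inl rfl),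
    h _ _ (.inr rfl) (.inr rfl)]

theorem genToFlex_tmul' {a : (variety k (asRel k)).obj (Fin 2)}
    (ha : a = mul k (asRel k) ∨ a = (variety k (asRel k)).flip (mul k (asRel k)))
    (b : (variety k (altRel k)).obj (Fin 2)) : genToFlex k (asAltTmul a b) = altToFlexTwo k b := by
  have h : (asToCom k).app _ a = (1 : k) := by
    rcases ha with rfl | rfl
    · exact asToCom_mul
    · rw [asToCom_flip]
      exact asToCom_mul
  rw [genToFlex_tmul, h]
  exact one_smul k _

/-- Each of the four associative composites is a word in which `x₃` stands at an end, hence `2 ≠ σ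
1`. This is all that is needed about the associative factor. -/
theorem exists_hadamardToFlexThree_compL {a a' : (variety k (asRel k)).obj (Fin 2)}
    (ha : a = mul k (asRel k) ∨ a = (variety k (asRel k)).flip (mul k (asRel k)))
    (ha' : a' = mul k (asRel k) ∨ a' = (variety k (asRel k)).flip (mul k (asRel k))) :
    ∃ σ : Equiv.Perm (Fin 3), 2 ≠ σ 1 ∧ ∀ c,
      hadamardToFlexThree k (asAltTmul ((variety k (asRel k)).compL a a') c) =
        (variety k (flexRel k)).map σ
          (altToFlexThree k ((variety k (altRel k)).map σ.symm c)) := by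
  rcases ha with rfl | rfl <;> rcases ha' with rfl | rfl
  · refine ⟨1, by decide, fun c => ?_⟩
    rw [compL_mul_mul, hadamardToFlexThree_opL]
  · refine ⟨Equiv.swap 0 1, by decide, fun c => ?_⟩
    rw [compL_mul_flip, hadamardToFlexThree_opL]
  · refine ⟨(finRotate 3).symm, by decide, fun c => ?_⟩
    rw [compL_flip_mul, hadamardToFlexThree_opR]
  · refine ⟨Equiv.swap 0 2, by decide, fun c => ?_⟩
    rw [compL_flip_flip, hadamardToFlexThree_opR]

/-- The outer letter of the alternative factor is also `x₃`, hence not the middle letter of the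
word, so the section fixes the monomial. -/
theorem hadamardToFlexThree_compL_tmul {a a' : (variety k (asRel k)).obj (Fin 2)}
    {b b' : (variety k (altRel k)).obj (Fin 2)}
    (ha : a = mul k (asRel k) ∨ a = (variety k (asRel k)).flip (mul k (asRel k)))
    (ha' : a' = mul k (asRel k) ∨ a' = (variety k (asRel k)).flip (mul k (asRel k)))
    (hb : b = mul k (altRel k) ∨ b = (variety k (altRel k)).flip (mul k (altRel k)))
    (hb' : b' = mul k (altRel k) ∨ b' = (variety k (altRel k)).flip (mul k (altRel k))) :
    hadamardToFlexThree k (asAltTmul ((variety k (asRel k)).compL a a')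
        ((variety k (altRel k)).compL b b')) =
      (variety k (flexRel k)).compL (altToFlexTwo k b) (altToFlexTwo k b') := by
  obtain ⟨σ, hσ, h⟩ := exists_hadamardToFlexThree_compL ha ha'
  rw [h]
  rcases hb with rfl | rfl <;> rcases hb' with rfl | rfl
  · rw [altToFlexTwo_mul, compL_mul_mul, compL_mul_mul, map_altToFlexThree_opL]
    exact hσ
  · rw [altToFlexTwo_flip, altToFlexTwo_mul, compL_mul_flip, compL_mul_flip, map_altToFlexThree_opL]
    exact hσ
  · rw [altToFlexTwo_flip, altToFlexTwo_mul, compL_flip_mul, compL_flip_mul, map_altToFlexThree_opR]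
    exact hσ
  · rw [altToFlexTwo_flip, altToFlexTwo_mul, compL_flip_flip, compL_flip_flip, map_altToFlexThree_opR]
    exact hσ

theorem exists_hadamardToFlexThree_compR {a a' : (variety k (asRel k)).obj (Fin 2)}
    (ha : a = mul k (asRel k) ∨ a = (variety k (asRel k)).flip (mul k (asRel k)))
    (ha' : a' = mul k (asRel k) ∨ a' = (variety k (asRel k)).flip (mul k (asRel k))) :
    ∃ σ : Equiv.Perm (Fin 3), 0 ≠ σ 1 ∧ ∀ c,
      hadamardToFlexThree k (asAltTmul ((variety k (asRel k)).compR a a') c) =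
        (variety k (flexRel k)).map σ
          (altToFlexThree k ((variety k (altRel k)).map σ.symm c)) := by
  rcases ha with rfl | rfl <;> rcases ha' with rfl | rfl
  · refine ⟨1, by decide, fun c => ?_⟩
    rw [compR_mul_mul, hadamardToFlexThree_opR]
  · refine ⟨Equiv.swap 1 2, by decide, fun c => ?_⟩
    rw [compR_mul_flip, hadamardToFlexThree_opR]
  · refine ⟨finRotate 3, by decide, fun c => ?_⟩
    rw [compR_flip_mul, hadamardToFlexThree_opL]
  · refine ⟨Equiv.swap 0 2, by decide, fun c => ?_⟩
    rw [compR_flip_flip, hadamardToFlexThree_opL]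

theorem hadamardToFlexThree_compR_tmul {a a' : (variety k (asRel k)).obj (Fin 2)}
    {b b' : (variety k (altRel k)).obj (Fin 2)}
    (ha : a = mul k (asRel k) ∨ a = (variety k (asRel k)).flip (mul k (asRel k)))
    (ha' : a' = mul k (asRel k) ∨ a' = (variety k (asRel k)).flip (mul k (asRel k)))
    (hb : b = mul k (altRel k) ∨ b = (variety k (altRel k)).flip (mul k (altRel k)))
    (hb' : b' = mul k (altRel k) ∨ b' = (variety k (altRel k)).flip (mul k (altRel k))) :
    hadamardToFlexThree k (asAltTmul ((variety k (asRel k)).compR a a')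
        ((variety k (altRel k)).compR b b')) =
      (variety k (flexRel k)).compR (altToFlexTwo k b) (altToFlexTwo k b') := by
  obtain ⟨σ, hσ, h⟩ := exists_hadamardToFlexThree_compR ha ha'
  rw [h]
  rcases hb with rfl | rfl <;> rcases hb' with rfl | rfl
  · rw [altToFlexTwo_mul, compR_mul_mul, compR_mul_mul, map_altToFlexThree_opR]
    exact hσ
  · rw [altToFlexTwo_flip, altToFlexTwo_mul, compR_mul_flip, compR_mul_flip, map_altToFlexThree_opR]
    exact hσ
  · rw [altToFlexTwo_flip, altToFlexTwo_mul, compR_flip_mul, compR_flip_mul, map_altToFlexThree_opL]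
    exact hσ
  · rw [altToFlexTwo_flip, altToFlexTwo_mul, compR_flip_flip, compR_flip_flip, map_altToFlexThree_opL]
    exact hσ

theorem hadamardToFlexThree_compL (g g' : (AsAlt k).obj (Fin 2)) :
    hadamardToFlexThree k ((AsAlt k).compL g g') =
      (variety k (flexRel k)).compL (genToFlex k g) (genToFlex k g') := by
  revert g g'
  have h : (AsAlt k).compL.compr₂ (hadamardToFlexThree k) =
      (variety k (flexRel k)).compL.compl₁₂ (genToFlex k) (genToFlex k) := by
    refine asAltTwo_ext fun a b ha hb => asAltTwo_ext fun a' b' ha' hb' => ?_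
    rw [LinearMap.compl₁₂_apply, genToFlex_tmul' ha, genToFlex_tmul' ha',
      ← hadamardToFlexThree_compL_tmul ha ha' hb hb', LinearMap.compr₂_apply,
      SymOperad.compL_tmul]
  exact fun g g' => LinearMap.congr_fun (LinearMap.congr_fun h g) g'

theorem hadamardToFlexThree_compR (g g' : (AsAlt k).obj (Fin 2)) :
    hadamardToFlexThree k ((AsAlt k).compR g g') =
      (variety k (flexRel k)).compR (genToFlex k g) (genToFlex k g') := by
  revert g g'
  have h : (AsAlt k).compR.compr₂ (hadamardToFlexThree k) =
      (variety k (flexRel k)).compR.compl₁₂ (genToFlex k) (genToFlex k) := by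
    refine asAltTwo_ext fun a b ha hb => asAltTwo_ext fun a' b' ha' hb' => ?_
    rw [LinearMap.compl₁₂_apply, genToFlex_tmul' ha, genToFlex_tmul' ha',
      ← hadamardToFlexThree_compR_tmul ha ha' hb hb', LinearMap.compr₂_apply,
      SymOperad.compR_tmul]
  exact fun g g' => LinearMap.congr_fun (LinearMap.congr_fun h g) g'

end

/-! ### Descent to the white product and to its quotient -/

/-- The morphism to `Flex` from the free operad on the elements of `As(2) ⊗ Alt(2)`. -/
def freeToFlex (k : Type u) [Field k] :
    (magmatic k ((AsAlt k).obj (Fin 2))).Hom (variety k (flexRel k)) :=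
  (variety k (flexRel k)).liftHom (genToFlex k)

theorem freeToFlex_gen (g : (AsAlt k).obj (Fin 2)) :
    (freeToFlex k).app _ (magmaticGen k g) = genToFlex k g :=
  SymOperad.liftHom_magmaticGen _ _ g

/-- The canonical morphism to `As ⊗ Alt` from the free operad on the elements of
`As(2) ⊗ Alt(2)`. -/
def freeToAsAlt (k : Type u) [Field k] :
    (magmatic k ((AsAlt k).obj (Fin 2))).Hom (AsAlt k) :=
  (AsAlt k).liftHom fun g => g

theorem freeToAsAlt_gen (g : (AsAlt k).obj (Fin 2)) :
    (freeToAsAlt k).app _ (magmaticGen k g) = g :=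
  SymOperad.liftHom_magmaticGen _ _ g

/-- The relations of arity two express linearity of the symbols and the action of the transposition;
they hold in `Flex` because `genToFlex` is linear and equivariant. -/
theorem freeToFlex_two (p : (magmatic k ((AsAlt k).obj (Fin 2))).obj (Fin 2)) :
    (freeToFlex k).app _ p = genToFlex k ((freeToAsAlt k).app _ p) := by
  revert p
  refine LinearMap.congr_fun (g := genToFlex k ∘ₗ (freeToAsAlt k).app _)
    (magmatic_linearMap_ext fun t => ?_)
  rw [LinearMap.comp_apply]
  obtain ⟨g, h | h⟩ := magmaticTerm_two (k := k) t
  · rw [h, freeToFlex_gen, freeToAsAlt_gen]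
  · rw [h, SymOperad.Hom.app_flip, SymOperad.Hom.app_flip, freeToFlex_gen, freeToAsAlt_gen,
      genToFlex_flip]

/-- The map to `Flex` factors through `As ⊗ Alt` in arity three, so it kills the kernel that defines
the relations of the white product. -/
theorem freeToFlex_three (p : (magmatic k ((AsAlt k).obj (Fin 2))).obj (Fin 3)) :
    (freeToFlex k).app _ p = hadamardToFlexThree k ((freeToAsAlt k).app _ p) := by
  revert p
  refine LinearMap.congr_fun (g := hadamardToFlexThree k ∘ₗ (freeToAsAlt k).app _)
    (magmatic_linearMap_ext fun t => ?_)
  rw [LinearMap.comp_apply]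
  obtain ⟨σ, g, g', h | h⟩ := magmaticTerm_three (k := k) t
  · rw [h, SymOperad.Hom.app_map, SymOperad.Hom.app_map, SymOperad.Hom.app_compL,
      SymOperad.Hom.app_compL, freeToFlex_gen, freeToFlex_gen, freeToAsAlt_gen, freeToAsAlt_gen,
      hadamardToFlexThree_map, hadamardToFlexThree_compL]
  · rw [h, SymOperad.Hom.app_map, SymOperad.Hom.app_map, SymOperad.Hom.app_compR,
      SymOperad.Hom.app_compR, freeToFlex_gen, freeToFlex_gen, freeToAsAlt_gen, freeToAsAlt_gen,
      hadamardToFlexThree_map, hadamardToFlexThree_compR]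

/-- The morphism `As ∘ Alt → Flex`. -/
def whiteToFlex (k : Type u) [Field k] :
    ((variety k (asRel k)).white (variety k (altRel k))).Hom (variety k (flexRel k)) :=
  (freeToFlex k).descend ((variety k (asRel k)).whiteRel (variety k (altRel k))) (by
    rintro ⟨n, p⟩ ⟨h | h, hp⟩
    · obtain rfl : n = 2 := h
      exact (freeToFlex_two p).trans ((congrArg (genToFlex k) hp).trans (map_zero _))
    · obtain rfl : n = 3 := h
      exact (freeToFlex_three p).trans ((congrArg (hadamardToFlexThree k) hp).trans (map_zero _)))

/-- The projection from the free operad to `As ∘ Alt`. -/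
def freeToWhite (k : Type u) [Field k] : (magmatic k ((AsAlt k).obj (Fin 2))).Hom
    ((variety k (asRel k)).white (variety k (altRel k))) :=
  (magmatic k ((AsAlt k).obj (Fin 2))).quotHom _

theorem whiteToFlex_freeToWhite {A : Type} [Finite A]
    (p : (magmatic k ((AsAlt k).obj (Fin 2))).obj A) :
    (whiteToFlex k).app A ((freeToWhite k).app A p) = (freeToFlex k).app A p :=
  rfl

/-- The element `x₁x₂ ⊗ x₁x₂` of `As(2) ⊗ Alt(2)`. -/
def genH (k : Type u) [Field k] : (AsAlt k).obj (Fin 2) :=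
  asAltTmul (variety.mul k (asRel k)) (variety.mul k (altRel k))

/-- The element `x₁x₂ ⊗ x₂x₁` of `As(2) ⊗ Alt(2)`. -/
def genG (k : Type u) [Field k] : (AsAlt k).obj (Fin 2) :=
  asAltTmul (variety.mul k (asRel k)) ((variety k (altRel k)).flip (variety.mul k (altRel k)))

theorem genH₁_eq : genH₁ (Alt k) (Alt.mul k) = (freeToWhite k).app _ (magmaticGen k (genH k)) :=
  rfl

theorem genG₁_eq : genG₁ (Alt k) (Alt.mul k) = (freeToWhite k).app _ (magmaticGen k (genG k)) :=
  rfl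

theorem genH₂_eq : genH₂ (Alt k) (Alt.mul k) =
    (freeToWhite k).app _ ((magmatic k _).flip (magmaticGen k (genH k))) :=
  rfl

theorem genG₂_eq : genG₂ (Alt k) (Alt.mul k) =
    (freeToWhite k).app _ ((magmatic k _).flip (magmaticGen k (genG k))) :=
  rfl

theorem genToFlex_genH : genToFlex k (genH k) = variety.mul k (flexRel k) :=
  (genToFlex_tmul' (.inl rfl) _).trans altToFlexTwo_mul

theorem genToFlex_genG : genToFlex k (genG k) =
    (variety k (flexRel k)).flip (variety.mul k (flexRel k)) :=
  (genToFlex_tmul' (.inl rfl) _).trans (altToFlexTwo_flip _)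

/-- The morphism from the symmetrization of `Alt` to `Flex`. -/
def symmetrizationToFlex (k : Type u) [Field k] :
    (symmetrization (Alt k) (Alt.mul k)).Hom (variety k (flexRel k)) :=
  (whiteToFlex k).descend _ (by
    rintro x (rfl | rfl)
    · change (whiteToFlex k).app (Fin 2) (genG₁ (Alt k) (Alt.mul k) - genH₂ _ _) = 0
      rw [genG₁_eq, genH₂_eq]
      refine (map_sub ((whiteToFlex k).app (Fin 2)) _ _).trans ?_
      rw [whiteToFlex_freeToWhite, whiteToFlex_freeToWhite, SymOperad.Hom.app_flip,
        freeToFlex_gen, freeToFlex_gen, genToFlex_genG, genToFlex_genH, sub_self]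
    · change (whiteToFlex k).app (Fin 2) (genG₂ (Alt k) (Alt.mul k) - genH₁ _ _) = 0
      rw [genG₂_eq, genH₁_eq]
      refine (map_sub ((whiteToFlex k).app (Fin 2)) _ _).trans ?_
      rw [whiteToFlex_freeToWhite, whiteToFlex_freeToWhite, SymOperad.Hom.app_flip,
        freeToFlex_gen, freeToFlex_gen, genToFlex_genG, genToFlex_genH, SymOperad.flip_flip,
        sub_self])

/-! ### The morphism from flexible algebras to the symmetrization -/

/-- The projection from `As ∘ Alt` to the symmetrization of `Alt`. -/
def whiteToSymmetrization (k : Type u) [Field k] :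
    ((variety k (asRel k)).white (variety k (altRel k))).Hom
      (symmetrization (Alt k) (Alt.mul k)) :=
  ((As k).white (Alt k)).quotHom _

/-- The projection from the free operad to the symmetrization of `Alt`. -/
def freeToSymmetrization (k : Type u) [Field k] : (magmatic k ((AsAlt k).obj (Fin 2))).Hom
    (symmetrization (Alt k) (Alt.mul k)) :=
  (whiteToSymmetrization k).comp (freeToWhite k)

theorem freeToSymmetrization_surjective {A : Type} [Finite A] :
    Function.Surjective ((freeToSymmetrization k).app A) :=
  (SymOperad.quotMk_surjective _ _).comp (SymOperad.quotMk_surjective _ _)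

theorem symmetrizationToFlex_freeToSymmetrization {A : Type} [Finite A]
    (p : (magmatic k ((AsAlt k).obj (Fin 2))).obj A) :
    (symmetrizationToFlex k).app A ((freeToSymmetrization k).app A p) =
      (freeToFlex k).app A p :=
  rfl

theorem freeToSymmetrization_eq_zero {n : ℕ} (hn : n = 2 ∨ n = 3)
    {p : (magmatic k ((AsAlt k).obj (Fin 2))).obj (Fin n)}
    (hp : (freeToAsAlt k).app _ p = 0) : (freeToSymmetrization k).app _ p = 0 := by
  have h : (freeToWhite k).app _ p = 0 := SymOperad.quotMk_eq_zero ⟨hn, hp⟩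
  change (whiteToSymmetrization k).app _ ((freeToWhite k).app _ p) = 0
  rw [h, map_zero]

/-- The binary operation of the symmetrization given by an element of `As(2) ⊗ Alt(2)`. -/
def symmetrizationGen (k : Type u) [Field k] : (AsAlt k).obj (Fin 2) →ₗ[k]
    (symmetrization (Alt k) (Alt.mul k)).obj (Fin 2) where
  toFun g := (freeToSymmetrization k).app _ (magmaticGen k g)
  -- The symbol of a sum and the sum of the symbols have the same value in `As ⊗ Alt`, so their
  -- difference is a relation of arity two.
  map_add' g g' := by
    rw [← sub_eq_zero, ← map_add, ← map_sub]
    apply freeToSymmetrization_eq_zero (.inl rfl)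
    rw [map_sub, map_add, freeToAsAlt_gen, freeToAsAlt_gen, freeToAsAlt_gen, sub_self]
  map_smul' c g := by
    rw [RingHom.id_apply, ← sub_eq_zero, ← map_smul, ← map_sub]
    apply freeToSymmetrization_eq_zero (.inl rfl)
    rw [map_sub, map_smul, freeToAsAlt_gen, freeToAsAlt_gen, sub_self]

theorem freeToSymmetrization_gen (g : (AsAlt k).obj (Fin 2)) :
    (freeToSymmetrization k).app _ (magmaticGen k g) = symmetrizationGen k g :=
  rfl

theorem symmetrizationGen_flip (g : (AsAlt k).obj (Fin 2)) :
    symmetrizationGen k ((AsAlt k).flip g) =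
      (symmetrization (Alt k) (Alt.mul k)).flip (symmetrizationGen k g) := by
  rw [← freeToSymmetrization_gen, ← freeToSymmetrization_gen, ← SymOperad.Hom.app_flip,
    ← sub_eq_zero, ← map_sub]
  apply freeToSymmetrization_eq_zero (.inl rfl)
  rw [map_sub, SymOperad.Hom.app_flip, freeToAsAlt_gen, freeToAsAlt_gen, sub_self]

theorem symmetrizationGen_genG : symmetrizationGen k (genG k) =
    (symmetrization (Alt k) (Alt.mul k)).flip (symmetrizationGen k (genH k)) := by
  have h := SymOperad.quotMk_eq_zero (P := (As k).white (Alt k))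
    (S := {⟨2, genG₁ (Alt k) (Alt.mul k) - genH₂ (Alt k) (Alt.mul k)⟩,
      ⟨2, genG₂ (Alt k) (Alt.mul k) - genH₁ (Alt k) (Alt.mul k)⟩}) (.inl rfl)
  rw [map_sub, sub_eq_zero] at h
  exact h

/-- All four composites lie over the word `x₁x₂x₃`, and the alternative factors add up to
`(x₁,x₂,x₃) + (x₃,x₂,x₁)`, which vanishes in `Alt`. Written with `genG` in place of flips of `genH`,
this is a relation of the white product itself. -/
theorem symmetrizationGen_compL_sub_compR :
    (symmetrization (Alt k) (Alt.mul k)).compL (symmetrizationGen k (genH k))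
        (symmetrizationGen k (genH k)) -
      (symmetrization (Alt k) (Alt.mul k)).compR (symmetrizationGen k (genH k))
        (symmetrizationGen k (genH k)) +
      ((symmetrization (Alt k) (Alt.mul k)).compR (symmetrizationGen k (genG k))
        (symmetrizationGen k (genG k)) -
      (symmetrization (Alt k) (Alt.mul k)).compL (symmetrizationGen k (genG k))
        (symmetrizationGen k (genG k))) = 0 := by
  simp only [← freeToSymmetrization_gen, ← SymOperad.Hom.app_compL, ← SymOperad.Hom.app_compR,
    ← map_sub, ← map_add]
  apply freeToSymmetrization_eq_zero (.inr rfl)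
  have has : variety.opL (asRel k) 1 = variety.opR (asRel k) 1 := by
    have h := SymOperad.quotMk_eq_zero (P := magmatic k Unit) (S := asRel k) (n := 3) rfl
    rw [variety.quotMk_associator] at h
    exact sub_eq_zero.1 h
  -- Alternative algebras are flexible: an odd permutation negates the associator.
  have halt := alt_opA (k := k) (Equiv.swap 0 2)
  rw [sgn_swap (by decide), neg_one_smul, eq_neg_iff_add_eq_zero, add_comm, variety.opA,
    variety.opA] at halt
  simp only [map_sub, map_add, SymOperad.Hom.app_compL, SymOperad.Hom.app_compR, freeToAsAlt_gen]
  rw [genH, genG, SymOperad.compL_tmul, SymOperad.compL_tmul, SymOperad.compR_tmul,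
    SymOperad.compR_tmul, variety.compL_mul_mul, variety.compL_mul_mul, variety.compR_mul_mul,
    variety.compR_mul_mul, variety.compL_flip_flip, variety.compR_flip_flip, has, ← map_sub,
    ← map_sub, ← map_add, halt, map_zero]

/-- The morphism from `Flex` to the symmetrization of `Alt`. -/
def flexToSymmetrization (k : Type u) [Field k] :
    (variety k (flexRel k)).Hom (symmetrization (Alt k) (Alt.mul k)) :=
  ((symmetrization (Alt k) (Alt.mul k)).liftHom
    (fun _ : Unit => symmetrizationGen k (genH k))).descend (flexRel k) (by
    rintro x rfl
    change ((symmetrization (Alt k) (Alt.mul k)).liftHom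
      (fun _ : Unit => symmetrizationGen k (genH k))).app (Fin 3)
        (associator k + (magmatic k Unit).map (Equiv.swap 0 2) (associator k)) = 0
    rw [associator_eq, ← compL_gen_eq_magL, ← compR_gen_eq_magR]
    simp only [map_add, map_sub, SymOperad.Hom.app_map, SymOperad.Hom.app_compL,
      SymOperad.Hom.app_compR, SymOperad.liftHom_magmaticGen]
    rw [← SymOperad.compL_flip_flip, ← SymOperad.compR_flip_flip, ← symmetrizationGen_genG]
    exact symmetrizationGen_compL_sub_compR)

theorem flexToSymmetrization_mul :
    (flexToSymmetrization k).app _ (variety.mul k (flexRel k)) = symmetrizationGen k (genH k) :=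
  SymOperad.liftHom_magmaticGen _ _ ()

/-- `genToFlex` forgets the associative factor. The added relation makes this harmless: `genG`
becomes the flip of `genH`, so all four basis tensors are determined by `genH` and the alternative
factor. -/
theorem flexToSymmetrization_genToFlex (g : (AsAlt k).obj (Fin 2)) :
    (flexToSymmetrization k).app _ (genToFlex k g) = symmetrizationGen k g := by
  revert g
  refine LinearMap.congr_fun (f := (flexToSymmetrization k).app _ ∘ₗ genToFlex k)
    (g := symmetrizationGen k) (asAltTwo_ext fun a b ha hb => ?_)
  have hH : asAltTmul (variety.mul k (asRel k)) (variety.mul k (altRel k)) = genH k := rfl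
  have hG : asAltTmul (variety.mul k (asRel k))
    ((variety k (altRel k)).flip (variety.mul k (altRel k))) = genG k := rfl
  have hH' : asAltTmul ((variety k (asRel k)).flip (variety.mul k (asRel k)))
    ((variety k (altRel k)).flip (variety.mul k (altRel k))) = (AsAlt k).flip (genH k) := rfl
  have hG' : asAltTmul ((variety k (asRel k)).flip (variety.mul k (asRel k)))
      (variety.mul k (altRel k)) = (AsAlt k).flip (genG k) := by
    rw [genG, SymOperad.flip_tmul, SymOperad.flip_flip]
  rw [LinearMap.comp_apply, genToFlex_tmul' ha]
  rcases ha with rfl | rfl <;> rcases hb with rfl | rfl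
  · rw [altToFlexTwo_mul, flexToSymmetrization_mul, hH]
  · rw [altToFlexTwo_flip, altToFlexTwo_mul, SymOperad.Hom.app_flip, flexToSymmetrization_mul,
      hG, symmetrizationGen_genG]
  · rw [altToFlexTwo_mul, flexToSymmetrization_mul, hG', symmetrizationGen_flip,
      symmetrizationGen_genG, SymOperad.flip_flip]
  · rw [altToFlexTwo_flip, altToFlexTwo_mul, SymOperad.Hom.app_flip, flexToSymmetrization_mul,
      hH', symmetrizationGen_flip]

/-- After lifting to the free operad both sides are morphisms, so agreement on the symbols suffices.
-/
theorem flexToSymmetrization_symmetrizationToFlex (A : Type) [Finite A]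
    (p : (symmetrization (Alt k) (Alt.mul k)).obj A) :
    (flexToSymmetrization k).app A ((symmetrizationToFlex k).app A p) = p := by
  obtain ⟨p, rfl⟩ := freeToSymmetrization_surjective p
  rw [symmetrizationToFlex_freeToSymmetrization]
  refine ((flexToSymmetrization k).comp (freeToFlex k)).magmatic_ext (freeToSymmetrization k)
    (fun g => ?_) A p
  rw [freeToSymmetrization_gen, ← flexToSymmetrization_genToFlex, ← freeToFlex_gen]
  rfl

theorem symmetrizationToFlex_flexToSymmetrization (A : Type) [Finite A]
    (q : (variety k (flexRel k)).obj A) :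
    (symmetrizationToFlex k).app A ((flexToSymmetrization k).app A q) = q := by
  obtain ⟨q, rfl⟩ := (magmatic k Unit).quotMk_surjective _ q
  refine (((symmetrizationToFlex k).comp (flexToSymmetrization k)).comp
    ((magmatic k Unit).quotHom (flexRel k))).magmatic_ext
    ((magmatic k Unit).quotHom (flexRel k)) (fun g => ?_) A q
  refine (congrArg ((symmetrizationToFlex k).app _) flexToSymmetrization_mul).trans ?_
  rw [← freeToSymmetrization_gen, symmetrizationToFlex_freeToSymmetrization, freeToFlex_gen,
    genToFlex_genH]
  rfl

/-- The symmetrization of `Alt` is isomorphic to `Flex`. -/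
def symmetrizationIsoFlex (k : Type u) [Field k] :
    (symmetrization (Alt k) (Alt.mul k)).Iso (Flex k) :=
  (symmetrizationToFlex k).toIso (flexToSymmetrization k)
    flexToSymmetrization_symmetrizationToFlex symmetrizationToFlex_flexToSymmetrization

theorem not_flex_iso_alt (k : Type u) [Field k] : ¬ Nonempty ((Flex k).Iso (Alt k)) := by
  rintro ⟨f⟩
  have h := (f.equiv (Fin 3)).finrank_eq
  rw [finrank_flex_three, finrank_alt_three] at h
  omega

end OperadTheory
end

theorem mainTheorem2 (k : Type u) [Field k] :
    ¬ OperadTheory.AdmitsNonsymmetricVersion (OperadTheory.Alt k) (OperadTheory.Alt.mul k) ∧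
    Nonempty ((OperadTheory.symmetrization (OperadTheory.Alt k) (OperadTheory.Alt.mul k)).Iso
      (OperadTheory.Flex k)) ∧
    Module.finrank k ((OperadTheory.Alt k).obj (Fin 3)) = 7 ∧
    Module.finrank k ((OperadTheory.Flex k).obj (Fin 3)) = 9 ∧
    ¬ Nonempty ((OperadTheory.Flex k).Iso (OperadTheory.Alt k)) := by
  refine ⟨?_, ⟨OperadTheory.symmetrizationIsoFlex k⟩, OperadTheory.finrank_alt_three,
    OperadTheory.finrank_flex_three, OperadTheory.not_flex_iso_alt k⟩
  rintro ⟨f⟩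
  exact OperadTheory.not_flex_iso_alt k ⟨(OperadTheory.symmetrizationIsoFlex k).symmTrans f⟩
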